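/- Let $(X,Y)$ be a random vector on $\mathbb R\times[0,\infty)$ with $t\,P[Y>ty]\to 1/y$ as $t\to\infty$ for every $y>0$. Let $K(y,A)$ be a transition function with values in the probability measures on $[-\infty,\infty]$ which is a version of the conditional distribution $P[X\in A\mid Y=y]$. Call a finite measure $m$ on $[-\infty,\infty]$ *non-degenerate* if $m(\mathbb R\setminus\{c\})>0$ for every $c\in\mathbb R$, i.e. if $x\mapsto m([-\infty,x])$ has at least two points of increase in $\mathbb R$. For $\rho,k\in\mathbb R$ and $x>0$ put $\psi(x)=k\rho^{-1}(x^\rho-1)$ if $\rho\neq0$ and $\psi(x)=k\log x$ if $\rho=0$. For $\alpha:(0,\infty)\to(0,\infty)$ and $\beta:(0,\infty)\to\mathbb R$ write $\alpha,\beta\in\mathrm{ERV}_{\rho,k}$ if, for every $x>0$, $\alpha(tx)/\alpha(t)\to x^\rho$ and $(\beta(tx)-\beta(t))/\alpha(t)\to\psi(x)$ as $t\to\infty$. Let $G$ be a non-degenerate probability distribution on $[-\infty,\infty)$, write $G(x)=G([-\infty,x])$, and assume that there are functions $\alpha(t)>0$, $\beta(t)\in\mathbb R$ on $(0,\infty)$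 such that, as $t\to\infty$, the probability measures with distribution functions $x\mapsto K(t,[-\infty,\alpha(t)x+\beta(t)])$ converge weakly on $[-\infty,\infty]$ to $G$. Then the following are equivalent: (a) there is a Radon measure $\mu\not\equiv0$ on $[-\infty,\infty]\times(0,\infty]$ such that, as $t\to\infty$, $$t\,P\Big[\Big(\tfrac{X-\beta(t)}{\alpha(t)},\tfrac Yt\Big)\in\cdot\Big]\to\mu(\cdot)\quad\text{vaguely on }[-\infty,\infty]\times(0,\infty],$$ and $\mu$ is conditionally non-degenerate: for every $y>0$, the measure $\mu(\,\cdot\times(y,\infty])$ is non-degenerate and $\mu(\{\infty\}\times(y,\infty])=0$; (b) $\alpha,\beta\in\mathrm{ERV}_{\rho,k}$ for some $\rho,k\in\mathbb R$. In this case, $\mu$ is given by $$\mu([-\infty,x]\times(y,\infty])=\int_{(y,\infty]}G\big(u^{-\rho}(x-\psi(u))\big)\,u^{-2}\,du,\qquad x\in\mathbb R,\ y>0 .$$ If $G$ is continuous on $\mathbb R$, this expression is continuous in $(x,y)\in\mathbb R\times(0,\infty)$. If $(\rho,k)\neq(0,0)$, it is continuous at every $(x,y)\in\mathbb R\times(0,\infty)$,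 except possibly, when $\rho\ne0$ and $G$ has an atom at $-k/\rho$, at the points with $x=-k/\rho$. -/

import Mathlib

open MeasureTheory ProbabilityTheory Filter Topology Set

noncomputable section

namespace CEVM

/-- The limit function of extended regular variation:
`ψ x = k (x ^ ρ - 1) / ρ` if `ρ ≠ 0`, and `ψ x = k log x` if `ρ = 0` (used for `x > 0`). -/
def psi (ρ k x : ℝ) : ℝ :=
  if ρ = 0 then k * Real.log x else k * (x ^ ρ - 1) / ρ

/-- `α, β` (functions on `(0, ∞)`) are extended regularly varying with parameters `ρ, k`. -/
def ERV (ρ k : ℝ) (α β : ℝ → ℝ) : Prop :=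
  (∀ x : ℝ, 0 < x → Tendsto (fun t => α (t * x) / α t) atTop (𝓝 (x ^ ρ))) ∧
  (∀ x : ℝ, 0 < x → Tendsto (fun t => (β (t * x) - β t) / α t) atTop (𝓝 (psi ρ k x)))

/-- A measure on `[-∞, ∞]` is non-degenerate if its finite part is not carried by one point:
no real `c` satisfies `m (ℝ \ {c}) = 0`. Equivalently, the function `x ↦ m [-∞, x]` has at least
two points of increase in `ℝ`. -/
def NonDegenerate (m : Measure EReal) : Prop :=
  ∀ c : ℝ, m (range ((↑) : ℝ → EReal) \ {(c : EReal)}) ≠ 0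

/-- The affine rescaling `e ↦ (e - b) / a` of `[-∞, ∞]`. For `a > 0` it fixes `±∞`. -/
def standardize (a b : ℝ) (e : EReal) : EReal := (e - (b : EReal)) / (a : EReal)

theorem measurable_standardize (a b : ℝ) : Measurable (standardize a b) := by
  unfold standardize
  simp only [sub_eq_add_neg, div_eq_mul_inv]
  fun_prop

theorem standardize_coe (a b x : ℝ) :
    standardize a b (x : EReal) = (((x - b) / a : ℝ) : EReal) := by
  simp [standardize, EReal.coe_div]

/-- The image of the distribution `K (t, ·)` under `e ↦ (e - β t) / α t`; for `α t > 0` its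
distribution function is `x ↦ K (t, [-∞, α t * x + β t])`. -/
def scaledKernel (K : Kernel ℝ EReal) [IsMarkovKernel K] (α β : ℝ → ℝ) (t : ℝ) :
    ProbabilityMeasure EReal :=
  ProbabilityMeasure.map ⟨K t, inferInstance⟩ (measurable_standardize (α t) (β t)).aemeasurable

/-- `K` is a version of the conditional distribution of `X` given `Y`:
`P (Y ∈ B, X ∈ A) = ∫ y in B, K (y, A) P_Y (dy)`. -/
def IsCondDistrib {Ω : Type*} [MeasurableSpace Ω] (P : Measure Ω) (X Y : Ω → ℝ)
    (K : Kernel ℝ EReal) : Prop :=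
  P.map (fun ω => (Y ω, (X ω : EReal))) = (P.map Y) ⊗ₘ K

/-- The standardized domain of attraction: `t P (Y > t y) → 1 / y` for all `y > 0`. -/
def StdDomainOfAttraction {Ω : Type*} [MeasurableSpace Ω] (P : Measure Ω) (Y : Ω → ℝ) : Prop :=
  ∀ y : ℝ, 0 < y → Tendsto (fun t : ℝ => t * P.real {ω | t * y < Y ω}) atTop (𝓝 y⁻¹)

/-- The space `[-∞, ∞] × (0, ∞]`. -/
abbrev Cone : Type := EReal × Ioi (0 : EReal)

/-- The measure `t P [((X - β t) / α t, Y / t) ∈ ·]` on `[-∞, ∞] × (0, ∞]`. -/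
def scaledLaw {Ω : Type*} [MeasurableSpace Ω] (P : Measure Ω) (X Y : Ω → ℝ) (α β : ℝ → ℝ)
    (t : ℝ) : Measure Cone :=
  ENNReal.ofReal t •
    (P.map (fun ω => ((((X ω - β t) / α t : ℝ) : EReal), ((Y ω / t : ℝ) : EReal)))).comap
      (Prod.map id Subtype.val)

theorem measurableEmbedding_cone :
    MeasurableEmbedding (Prod.map id Subtype.val : Cone → EReal × EReal) :=
  MeasurableEmbedding.id.prodMap (MeasurableEmbedding.subtype_coe measurableSet_Ioi)

theorem scaledLaw_apply {Ω : Type*} [MeasurableSpace Ω] (P : Measure Ω) {X Y : Ω → ℝ}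
    (hX : Measurable X) (hY : Measurable Y) (α β : ℝ → ℝ) (t : ℝ) {A : Set Cone}
    (hA : MeasurableSet A) :
    scaledLaw P X Y α β t A = ENNReal.ofReal t * P {ω | ∃ p ∈ A,
      p.1 = (((X ω - β t) / α t : ℝ) : EReal) ∧ (p.2 : EReal) = ((Y ω / t : ℝ) : EReal)} := by
  have hm : Measurable
      (fun ω => ((((X ω - β t) / α t : ℝ) : EReal), ((Y ω / t : ℝ) : EReal))) := by
    fun_prop
  rw [scaledLaw, Measure.smul_apply, measurableEmbedding_cone.comap_apply,
    Measure.map_apply hm (measurableEmbedding_cone.measurableSet_image.2 hA), smul_eq_mul]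
  congr 2
  ext ω
  simp [Prod.map, Prod.ext_iff]

/-- Vague convergence as `t → ∞`: convergence of the integrals of all continuous functions with
compact support in `[-∞, ∞] × (0, ∞]`. -/
def VagueTendsto (m : ℝ → Measure Cone) (μ : Measure Cone) : Prop :=
  ∀ f : Cone → ℝ, Continuous f → HasCompactSupport f →
    Tendsto (fun t => ∫ p, f p ∂(m t)) atTop (𝓝 (∫ p, f p ∂μ))

/-- The measure `A ↦ μ (A × (y, ∞])` on `[-∞, ∞]`. -/
def slice (μ : Measure Cone) (y : ℝ) : Measure EReal :=
  (μ.restrict {p : Cone | (y : EReal) < (p.2 : EReal)}).map Prod.fst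

/-- Conditional non-degeneracy: for each `y > 0`, the measure `μ (· × (y, ∞])` is non-degenerate
and has no mass at `+∞`. -/
def CondNonDegenerate (μ : Measure Cone) : Prop :=
  ∀ y : ℝ, 0 < y → NonDegenerate (slice μ y) ∧ slice μ y {⊤} = 0

/-- `(X, Y)` follows the conditional extreme value model with normalization `α, β` for `X` and
`t, 0` for `Y`, with limit measure `μ`. On the locally compact, second countable, metrizable space
`[-∞, ∞] × (0, ∞]`, a Borel measure is Radon iff it is finite on compact sets. -/
structure IsCEVMLimit {Ω : Type*} [MeasurableSpace Ω] (P : Measure Ω) (X Y : Ω → ℝ)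
    (α β : ℝ → ℝ) (μ : Measure Cone) : Prop where
  radon : IsFiniteMeasureOnCompacts μ
  tendsto : VagueTendsto (scaledLaw P X Y α β) μ
  ne_zero : μ ≠ 0
  nonDegenerate : CondNonDegenerate μ

/-- `∫_{(y, ∞]} G (u ^ (-ρ) * (x - ψ u)) u ^ (-2) du`, where `G z = G [-∞, z]` is the distribution
function of `G`. -/
def limitFun (G : Measure EReal) (ρ k x y : ℝ) : ENNReal :=
  ∫⁻ u in Ioi y, G (Iic ((u ^ (-ρ) * (x - psi ρ k u) : ℝ) : EReal)) * ENNReal.ofReal (u ^ (-2 : ℝ))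

end CEVM

end

noncomputable section

namespace CEVM

/-! Write `Z` for a variable with law `G`, and test the vague convergence in (a) with products
g(x)φ(y), where φ is a continuous weight vanishing near 0. Weighting `P` by t φ(Y/t) and normalizing
`X` at t gives finite measures on [-∞,∞] that converge to a weighted marginal of μ, which is
non-degenerate and has no mass at +∞. Normalizing at tc instead of t is one further affine map,
whose parameters are exactly the ratios α(tc)/α(t) and (β(tc)-β(t))/α(t). Their limits are therefore
a matter of convergence of types.

That principle needs care, because mass may sit at -∞. If half the mass of T_n has a fixed
non-degenerate law on ℝ and the other half sits at -n, then the scales 1 and n both give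
non-degenerate limits; so different limits do not force comparable scales. Equal limits do: if the
scale ratio degenerated, all real mass of the limit would collapse into a single atom of that same
limit (`measure_le_singleton_of_tendsto`). Since only the identity preserves a non-degenerate
measure, the connecting maps tend to the identity (`tendsto_one_zero_of_same_limit`).

(a) implies (b): as (t,c) → (∞,1), replacing t φ(Y/t) by tc φ(Y/(tc)) changes the integrals
negligibly, so both normalizations have the same limit and the ratios tend to (1,0). Chaining n
steps of size c^(1/n) bounds α(tc)/α(t) above and away from 0 for each fixed c, and then every
subsequential limit is the unique affine map between two fixed measures
(`exists_tendsto_of_scale_bounded`). The limits satisfy a cocycle equation, and continuity at 1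
forces the solution x^ρ, ψ(x).

(b) implies (a): the pointwise limits must become locally uniform although α and β need not be
measurable. Mix K(tu,·) over u in (1,2]. By dominated convergence the mixture, normalized at t or at
tc, has the same limit as (t,c) → (∞,1), so the ratios again tend to (1,0). Hence K(tu,·) normalized
at t converges, locally uniformly in u > 0, to the law of u^ρ Z + ψ(u). As t P[Y/t ∈ ·] tends to
u^(-2) du, integrating out the kernel gives the image of u^(-2) du × G as limit.

Uniqueness of vague limits yields the formula for μ. For continuity when (ρ,k) ≠ (0,0), u ↦
u^(-ρ)(x-ψ(u)) is injective unless x is the common fixed point -k/ρ, so it meets the countably many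
atoms of `G` for only countably many u. -/

/-! ### Affine maps of the extended real line -/

theorem standardize_bot {a : ℝ} (ha : 0 < a) (b : ℝ) : standardize a b ⊥ = ⊥ := by
  rw [standardize, EReal.bot_sub]
  exact EReal.bot_div_of_pos_ne_top (by exact_mod_cast ha) (EReal.coe_ne_top a)

theorem standardize_top {a : ℝ} (ha : 0 < a) (b : ℝ) : standardize a b ⊤ = ⊤ := by
  rw [standardize, EReal.top_sub_coe]
  exact EReal.top_div_of_pos_ne_top (by exact_mod_cast ha) (EReal.coe_ne_top a)

theorem standardize_standardize {a a' : ℝ} (ha : 0 < a) (ha' : 0 < a') (b b' : ℝ) (e : EReal) :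
    standardize a' b' (standardize a b e) = standardize (a * a') (b + a * b') e := by
  induction e with
  | bot => rw [standardize_bot ha, standardize_bot ha', standardize_bot (mul_pos ha ha')]
  | top => rw [standardize_top ha, standardize_top ha', standardize_top (mul_pos ha ha')]
  | coe x =>
    rw [standardize_coe, standardize_coe, standardize_coe]
    congr 1
    field_simp
    ring

theorem standardize_one_zero (e : EReal) : standardize 1 0 e = e := by
  simp [standardize]

/-- In this form the factor is finite and nonzero and the summand is finite, so no indeterminate
expression occurs and the continuity of extended-real arithmetic applies. -/
theorem standardize_eq_mul_add {a : ℝ} (ha : 0 < a) (b : ℝ) (e : EReal) :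
    standardize a b e = e * ((a⁻¹ : ℝ) : EReal) + ((-b / a : ℝ) : EReal) := by
  induction e with
  | bot =>
    rw [standardize_bot ha, EReal.bot_mul_coe_of_pos (inv_pos.2 ha), EReal.bot_add]
  | top =>
    rw [standardize_top ha, EReal.top_mul_coe_of_pos (inv_pos.2 ha), EReal.top_add_coe]
  | coe x =>
    rw [standardize_coe]
    norm_cast
    field_simp
    ring

theorem tendsto_standardize {ι : Type*} {l : Filter ι} {A B : ι → ℝ} {f : ι → EReal} {a b : ℝ}
    {e : EReal} (ha : 0 < a) (hA : Tendsto A l (𝓝 a)) (hB : Tendsto B l (𝓝 b))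
    (hf : Tendsto f l (𝓝 e)) :
    Tendsto (fun i => standardize (A i) (B i) (f i)) l (𝓝 (standardize a b e)) := by
  have hpos : ∀ᶠ i in l, 0 < A i := hA.eventually_const_lt ha
  rw [standardize_eq_mul_add ha]
  have h1 : Tendsto (fun i => (((A i)⁻¹ : ℝ) : EReal)) l (𝓝 ((a⁻¹ : ℝ) : EReal)) :=
    EReal.tendsto_coe.2 (hA.inv₀ ha.ne')
  have h2 : Tendsto (fun i => ((-B i / A i : ℝ) : EReal)) l (𝓝 ((-b / a : ℝ) : EReal)) :=
    EReal.tendsto_coe.2 (hB.neg.div hA ha.ne')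
  have hne : ((a⁻¹ : ℝ) : EReal) ≠ 0 := by
    exact_mod_cast (inv_pos.2 ha).ne'
  have h3 := (EReal.continuousAt_mul (p := (e, ((a⁻¹ : ℝ) : EReal)))
    (Or.inr (EReal.coe_ne_bot _)) (Or.inr (EReal.coe_ne_top _)) (Or.inr hne)
    (Or.inr hne)).tendsto.comp (hf.prodMk_nhds h1)
  have h4 := (EReal.continuousAt_add
    (p := (e * ((a⁻¹ : ℝ) : EReal), ((-b / a : ℝ) : EReal)))
    (Or.inr (EReal.coe_ne_bot _)) (Or.inr (EReal.coe_ne_top _))).tendsto.comp (h3.prodMk_nhds h2)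
  refine h4.congr' ?_
  filter_upwards [hpos] with i hi
  rw [standardize_eq_mul_add hi]
  rfl

theorem continuous_standardize {a : ℝ} (ha : 0 < a) (b : ℝ) : Continuous (standardize a b) :=
  continuous_iff_continuousAt.2 fun _ =>
    tendsto_standardize ha tendsto_const_nhds tendsto_const_nhds tendsto_id

/-! ### Rigidity of non-degenerate measures under affine maps -/

theorem integrable_of_continuous {H : Measure EReal} [IsFiniteMeasure H] {g : EReal → ℝ}
    (hg : Continuous g) : Integrable g H := by
  obtain ⟨C, hC⟩ := isCompact_univ.exists_bound_of_continuousOn (f := g) hg.continuousOn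
  exact Integrable.of_bound hg.aestronglyMeasurable C (ae_of_all _ fun x => hC x (mem_univ x))

/-- The decreasing logistic function on the extended real line. -/
def logistic (e : EReal) : ℝ := ((1 + e.exp)⁻¹).toReal

theorem continuous_logistic : Continuous logistic := by
  rw [continuous_iff_continuousAt]
  intro e
  have h1 : Continuous fun e : EReal => (1 + e.exp)⁻¹ :=
    (continuous_const.add ENNReal.continuous_exp).inv
  refine (ENNReal.tendsto_toReal ?_).comp h1.continuousAt
  simp

theorem logistic_coe (x : ℝ) : logistic (x : EReal) = (1 + Real.exp x)⁻¹ := by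
  have : (1 : ENNReal) + ENNReal.ofReal (Real.exp x) = ENNReal.ofReal (1 + Real.exp x) := by
    rw [ENNReal.ofReal_add zero_le_one (Real.exp_pos x).le, ENNReal.ofReal_one]
  rw [logistic, EReal.exp_coe, this, ENNReal.toReal_inv, ENNReal.toReal_ofReal (by positivity)]

/-- The even bump function `(1 + exp z)⁻¹ (1 + exp (-z))⁻¹`, where `z = x - c`. -/
def bump (c : ℝ) (e : EReal) : ℝ := logistic (standardize 1 c e) * logistic (-standardize 1 c e)

theorem continuous_bump (c : ℝ) : Continuous (bump c) :=
  (continuous_logistic.comp (continuous_standardize one_pos c)).mul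
    (continuous_logistic.comp (continuous_neg.comp (continuous_standardize one_pos c)))

theorem bump_coe (c x : ℝ) : bump c (x : EReal) = (2 + 2 * Real.cosh (x - c))⁻¹ := by
  rw [bump, standardize_coe, div_one, ← EReal.coe_neg, logistic_coe, logistic_coe, ← mul_inv]
  congr 1
  have h : Real.exp (x - c) * Real.exp (-(x - c)) = 1 := by
    rw [← Real.exp_add]; simp
  rw [Real.cosh_eq]
  linear_combination h

/-- The point -b/(a-1) is the fixed point of x ↦ (x-b)/a, which divides the distance to it by a > 1;
the bump strictly decreases in that distance. -/
theorem bump_standardize_lt {a : ℝ} (ha : 1 < a) (b : ℝ) {x : ℝ} (hx : x ≠ -b / (a - 1)) :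
    bump (-b / (a - 1)) x < bump (-b / (a - 1)) (standardize a b x) := by
  set c := -b / (a - 1) with hc
  have h1 : a - 1 ≠ 0 := by linarith
  have hb : b = -(c * (a - 1)) := by rw [hc]; field_simp
  have h2 : (x - b) / a - c = (x - c) / a := by
    rw [hb]; field_simp; ring
  rw [standardize_coe, bump_coe, bump_coe, h2]
  refine inv_strictAnti₀ (by positivity) ?_
  have h3 : Real.cosh ((x - c) / a) < Real.cosh (x - c) := by
    rw [Real.cosh_lt_cosh, abs_div, abs_of_pos (by linarith : 0 < a)]
    exact div_lt_self (abs_pos.2 (sub_ne_zero.2 hx)) ha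
  linarith

theorem bump_le_bump_standardize {a : ℝ} (ha : 1 < a) (b : ℝ) (e : EReal) :
    bump (-b / (a - 1)) e ≤ bump (-b / (a - 1)) (standardize a b e) := by
  induction e with
  | bot => rw [standardize_bot (by linarith)]
  | top => rw [standardize_top (by linarith)]
  | coe x =>
    by_cases hx : x = -b / (a - 1)
    · have h1 : a - 1 ≠ 0 := by linarith
      have h2 : a ≠ 0 := by linarith
      have : (x - b) / a = x := by rw [hx]; field_simp; ring
      rw [standardize_coe, this]
    · exact (bump_standardize_lt ha b hx).le

theorem NonDegenerate.range_ne_zero {H : Measure EReal} (hH : NonDegenerate H) :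
    H (range ((↑) : ℝ → EReal)) ≠ 0 := fun h =>
  hH 0 (measure_mono_null sdiff_subset h)

/-- A Lyapunov function for `S` with unchanged integral is constant along `S` almost everywhere. The
bump serves for expansions, `logistic` for translations. -/
theorem measure_eq_zero_of_integral_comp_eq {H : Measure EReal} [IsFiniteMeasure H]
    {S : EReal → EReal} (hS : Continuous S) {g : EReal → ℝ} (hg : Continuous g)
    (hint : ∫ x, g (S x) ∂H = ∫ x, g x ∂H) (hle : ∀ x, g x ≤ g (S x)) :
    H {x | g x ≠ g (S x)} = 0 := by
  have h := (integral_eq_iff_of_ae_le (integrable_of_continuous hg)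
    (integrable_of_continuous (hg.comp hS)) (ae_of_all H hle)).1 hint.symm
  exact ae_iff.1 h

/-- An affine transformation preserving a non-degenerate finite measure is not an expansion. -/
theorem not_one_lt_of_integral_comp_standardize {H : Measure EReal} [IsFiniteMeasure H]
    (hH : NonDegenerate H) {a b : ℝ}
    (h : ∀ g : EReal → ℝ, Continuous g → ∫ x, g (standardize a b x) ∂H = ∫ x, g x ∂H) :
    ¬ 1 < a := by
  intro ha
  have h0 := measure_eq_zero_of_integral_comp_eq (continuous_standardize (by linarith) b)
    (continuous_bump _) (h _ (continuous_bump (-b / (a - 1)))) (bump_le_bump_standardize ha b)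
  refine hH (-b / (a - 1)) (measure_mono_null ?_ h0)
  rintro _ ⟨⟨x, rfl⟩, hx⟩
  exact (bump_standardize_lt ha b (by simpa using hx)).ne

theorem integral_comp_standardize_inv {H H' : Measure EReal} {a b : ℝ} (ha : 0 < a)
    (h : ∀ g : EReal → ℝ, Continuous g → ∫ x, g (standardize a b x) ∂H = ∫ x, g x ∂H')
    (g : EReal → ℝ) (hg : Continuous g) :
    ∫ x, g (standardize a⁻¹ (-b / a) x) ∂H' = ∫ x, g x ∂H := by
  have h1 := h _ (hg.comp (continuous_standardize (inv_pos.2 ha) (-b / a)))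
  refine h1.symm.trans ?_
  congr 1 with x
  have h0 : b + a * (-b / a) = 0 := by field_simp; ring
  rw [Function.comp_apply, standardize_standardize ha (inv_pos.2 ha), h0, mul_inv_cancel₀ ha.ne',
    standardize_one_zero]

/-- A non-degenerate finite measure is preserved by no affine transformation but the identity. -/
theorem eq_one_and_eq_zero_of_integral_comp_standardize {H : Measure EReal} [IsFiniteMeasure H]
    (hH : NonDegenerate H) {a b : ℝ} (ha : 0 < a)
    (h : ∀ g : EReal → ℝ, Continuous g → ∫ x, g (standardize a b x) ∂H = ∫ x, g x ∂H) :
    a = 1 ∧ b = 0 := by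
  have h1 : a ≤ 1 := not_lt.1 (not_one_lt_of_integral_comp_standardize hH h)
  -- The inverse map preserves `H` too, hence is not an expansion either.
  have h2 : a⁻¹ ≤ 1 := not_lt.1
    (not_one_lt_of_integral_comp_standardize hH (integral_comp_standardize_inv ha h))
  have h3 : a = 1 := le_antisymm h1 (by simpa using (inv_le_one₀ ha).1 h2)
  subst h3
  refine ⟨rfl, ?_⟩
  -- The scale being 1, a positive shift moves every real point to the left, and the decreasing
  -- `logistic` strictly increases. A negative shift is handled through the inverse map.
  have key : ∀ c : ℝ, 0 < c → ¬ (∀ g : EReal → ℝ, Continuous g →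
      ∫ x, g (standardize 1 c x) ∂H = ∫ x, g x ∂H) := by
    intro c hc h'
    have hlt : ∀ x : ℝ, logistic x < logistic (standardize 1 c x) := by
      intro x
      rw [standardize_coe, div_one, logistic_coe, logistic_coe]
      refine inv_strictAnti₀ (by positivity) ?_
      have := Real.exp_lt_exp.2 (by linarith : x - c < x)
      linarith
    have h0 := measure_eq_zero_of_integral_comp_eq (continuous_standardize one_pos c)
      continuous_logistic (h' _ continuous_logistic) (fun e => by
        induction e with
        | bot => rw [standardize_bot one_pos]
        | top => rw [standardize_top one_pos]
        | coe x => exact (hlt x).le)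
    refine hH.range_ne_zero (measure_mono_null ?_ h0)
    rintro _ ⟨x, rfl⟩
    exact (hlt x).ne
  rcases lt_trichotomy b 0 with hb | hb | hb
  · have := integral_comp_standardize_inv ha h
    rw [inv_one, div_one] at this
    exact absurd this (key (-b) (by linarith))
  · exact hb
  · exact absurd h (key b hb)

/-- If two affine transformations map a non-degenerate measure to the same measure,
they are equal. -/
theorem standardize_unique {H H' : Measure EReal} [IsFiniteMeasure H]
    (hH : NonDegenerate H) {a b a' b' : ℝ} (ha : 0 < a) (ha' : 0 < a')
    (h : ∀ g : EReal → ℝ, Continuous g → ∫ x, g (standardize a b x) ∂H = ∫ x, g x ∂H')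
    (h' : ∀ g : EReal → ℝ, Continuous g → ∫ x, g (standardize a' b' x) ∂H = ∫ x, g x ∂H') :
    a = a' ∧ b = b' := by
  -- The first map followed by the inverse of the second preserves `H`.
  have key : ∀ g : EReal → ℝ, Continuous g →
      ∫ x, g (standardize (a * a'⁻¹) (b + a * (-b' / a')) x) ∂H = ∫ x, g x ∂H := by
    intro g hg
    rw [← integral_comp_standardize_inv ha' h' g hg]
    refine Eq.trans ?_ (h _ (hg.comp (continuous_standardize (inv_pos.2 ha') (-b' / a'))))
    congr 1 with x
    rw [← standardize_standardize ha (inv_pos.2 ha')]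
  obtain ⟨h1, h2⟩ := eq_one_and_eq_zero_of_integral_comp_standardize hH (by positivity) key
  have h3 : a = a' := by field_simp at h1; exact h1
  subst h3
  refine ⟨rfl, ?_⟩
  field_simp at h2
  linarith

/-! ### Convergence of types on [-∞,∞] -/

/-- Mass that is asymptotically mapped to a point `D` produces an atom of the limit at `D`. -/
theorem measure_le_singleton_of_tendsto {T : ℕ → Measure EReal} [∀ n, IsFiniteMeasure (T n)]
    {H H' : Measure EReal} [IsFiniteMeasure H] [IsFiniteMeasure H'] {S : ℕ → EReal → EReal}
    (hS : ∀ n, Continuous (S n))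
    (hT : ∀ g : EReal → ℝ, Continuous g → Tendsto (fun n => ∫ x, g x ∂(T n)) atTop
      (𝓝 (∫ x, g x ∂H)))
    (hT' : ∀ g : EReal → ℝ, Continuous g → Tendsto (fun n => ∫ x, g (S n x) ∂(T n)) atTop
      (𝓝 (∫ x, g x ∂H')))
    {E : Set EReal} (hE : IsOpen E) {D : EReal}
    (hD : ∀ x ∈ E, Tendsto (fun p : ℕ × EReal => S p.1 p.2) (atTop ×ˢ 𝓝 x) (𝓝 D)) :
    H E ≤ H' {D} := by
  by_contra! hlt
  -- Outer regularity at D and inner regularity of `E` keep the strict inequality, now between an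
  -- open `U` and a compact `K`; Urysohn functions for `K` and `U` turn it into one between
  -- integrals.
  obtain ⟨U, hDU, hU, hUlt⟩ := Set.exists_isOpen_lt_of_lt {D} _ hlt
  obtain ⟨K, hKE, hK, hKlt⟩ := hE.exists_lt_isCompact hUlt
  obtain ⟨K', hK', hKK', hK'E⟩ := exists_compact_between hK hE hKE
  obtain ⟨χ, hχ0, hχ1, hχ⟩ := exists_continuous_zero_one_of_isClosed
    (isOpen_interior (s := K')).isClosed_compl hK.isClosed
    (disjoint_left.2 fun x hx hxK => hx (hKK' hxK))
  obtain ⟨W, hW, hDW, hWU⟩ := exists_compact_between (isCompact_singleton (x := D)) hU hDU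
  obtain ⟨h, hh0, hh1, hh⟩ := exists_continuous_zero_one_of_isClosed
    hU.isClosed_compl hW.isClosed (disjoint_left.2 fun x hx hxW => hx (hWU hxW))
  -- Convergence jointly in n and the point is uniform over the compact set `K'`.
  have hev : ∀ᶠ n in atTop, ∀ x ∈ K', S n x ∈ W := by
    have : ∀ᶠ p : ℕ × EReal in atTop ×ˢ 𝓝ˢ K', S p.1 p.2 ∈ W := by
      rw [hK'.prod_nhdsSet_eq_biSup]
      simp only [eventually_iSup]
      intro x hx
      exact (hD x (hK'E hx)).eventually
        (mem_of_superset (isOpen_interior.mem_nhds (hDW rfl)) interior_subset)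
    filter_upwards [this.curry] with n hn x hx
    exact hn.self_of_nhdsSet x hx
  have hle : ∀ᶠ n in atTop, ∫ x, χ x ∂(T n) ≤ ∫ x, h (S n x) ∂(T n) := by
    filter_upwards [hev] with n hn
    refine integral_mono (integrable_of_continuous χ.continuous)
      (integrable_of_continuous (h.continuous.comp (hS n))) fun x => ?_
    by_cases hx : x ∈ K'
    · rw [hh1 (hn x hx)]
      exact (hχ x).2
    · rw [hχ0 (fun hx' => hx (interior_subset hx'))]
      exact (hh _).1
  have h1 := le_of_tendsto_of_tendsto (hT χ χ.continuous) (hT' h h.continuous) hle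
  have h2 : H.real K ≤ ∫ x, χ x ∂H := by
    rw [← integral_indicator_one hK.measurableSet]
    refine integral_mono ((integrable_indicator_iff hK.measurableSet).2
      (integrable_const _).integrableOn) (integrable_of_continuous χ.continuous) fun x => ?_
    by_cases hx : x ∈ K
    · simp [hx, hχ1 hx]
    · simpa [hx] using (hχ x).1
  have h3 : ∫ x, h x ∂H' ≤ H'.real U := by
    rw [← integral_indicator_one hU.measurableSet]
    refine integral_mono (integrable_of_continuous h.continuous)
      ((integrable_indicator_iff hU.measurableSet).2 (integrable_const _).integrableOn) fun x => ?_
    by_cases hx : x ∈ U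
    · simpa [hx] using (hh x).2
    · simp [hx, hh0 (show x ∈ Uᶜ from hx)]
  have h4 : (H K).toReal ≤ (H' U).toReal := h2.trans (h1.trans h3)
  rw [ENNReal.toReal_le_toReal (measure_ne_top _ _) (measure_ne_top _ _)] at h4
  exact absurd h4 (not_le.2 hKlt)

/-- At a real point the product tends to the real number x * C, even for C = 0, so the sum is never
indeterminate, whatever D is. -/
theorem tendsto_standardize_of_coe {A B : ℕ → ℝ} (hA : ∀ n, 0 < A n) {C : ℝ} {D : EReal}
    (hC : Tendsto (fun n => (A n)⁻¹) atTop (𝓝 C))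
    (hD : Tendsto (fun n => ((-B n / A n : ℝ) : EReal)) atTop (𝓝 D)) (x : ℝ) :
    Tendsto (fun p : ℕ × EReal => standardize (A p.1) (B p.1) p.2) (atTop ×ˢ 𝓝 (x : EReal))
      (𝓝 ((x : EReal) * (C : EReal) + D)) := by
  have h3 := (EReal.continuousAt_mul (p := ((x : EReal), (C : EReal)))
    (Or.inr (EReal.coe_ne_bot _)) (Or.inr (EReal.coe_ne_top _)) (Or.inl (EReal.coe_ne_bot _))
    (Or.inl (EReal.coe_ne_top _))).tendsto.comp
    ((tendsto_snd (f := (atTop : Filter ℕ)) (g := 𝓝 (x : EReal))).prodMk_nhds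
      ((EReal.tendsto_coe.2 hC).comp tendsto_fst))
  have h4 := (EReal.continuousAt_add (p := ((x : EReal) * (C : EReal), D))
    (Or.inl (by rw [← EReal.coe_mul]; exact EReal.coe_ne_top _))
    (Or.inl (by rw [← EReal.coe_mul]; exact EReal.coe_ne_bot _))).tendsto.comp
    (h3.prodMk_nhds (hD.comp tendsto_fst))
  refine h4.congr fun p => ?_
  rw [standardize_eq_mul_add (hA p.1)]
  rfl

/-- If A⁻¹ → 0 the product is indeterminate at -∞. It is nevertheless at most 0 near -∞, so the
summand alone drives the sum to -∞. -/
theorem tendsto_standardize_bot_of_bot {A B : ℕ → ℝ} (hA : ∀ n, 0 < A n)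
    (hD : Tendsto (fun n => ((-B n / A n : ℝ) : EReal)) atTop (𝓝 ⊥)) :
    Tendsto (fun p : ℕ × EReal => standardize (A p.1) (B p.1) p.2) (atTop ×ˢ 𝓝 ⊥) (𝓝 ⊥) := by
  refine tendsto_of_tendsto_of_tendsto_of_le_of_le' tendsto_const_nhds
    (hD.comp (tendsto_fst (f := (atTop : Filter ℕ)) (g := 𝓝 (⊥ : EReal))))
    (Eventually.of_forall fun _ => bot_le) ?_
  filter_upwards [tendsto_snd.eventually (eventually_lt_nhds (EReal.bot_lt_zero))] with p hp
  rw [standardize_eq_mul_add (hA p.1)]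
  have h1 : p.2 * (((A p.1)⁻¹ : ℝ) : EReal) ≤ 0 :=
    EReal.mul_nonpos_iff.2 (Or.inr ⟨hp.le, by exact_mod_cast (inv_pos.2 (hA p.1)).le⟩)
  calc p.2 * (((A p.1)⁻¹ : ℝ) : EReal) + ((-B p.1 / A p.1 : ℝ) : EReal)
      ≤ 0 + ((-B p.1 / A p.1 : ℝ) : EReal) := by gcongr
    _ = _ := zero_add _

theorem isOpen_range_coe : IsOpen (range ((↑) : ℝ → EReal)) :=
  EReal.isOpenEmbedding_coe.isOpen_range

theorem measure_univ_eq_of_tendsto {T : ℕ → Measure EReal} {H H' : Measure EReal}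
    [IsFiniteMeasure H] [IsFiniteMeasure H'] {S : ℕ → EReal → EReal}
    (hT : ∀ g : EReal → ℝ, Continuous g → Tendsto (fun n => ∫ x, g x ∂(T n)) atTop
      (𝓝 (∫ x, g x ∂H)))
    (hT' : ∀ g : EReal → ℝ, Continuous g → Tendsto (fun n => ∫ x, g (S n x) ∂(T n)) atTop
      (𝓝 (∫ x, g x ∂H'))) : H univ = H' univ := by
  have h := tendsto_nhds_unique (hT _ (continuous_const (y := (1 : ℝ))))
    (hT' _ (continuous_const (y := (1 : ℝ))))
  rw [integral_const, integral_const, smul_eq_mul, smul_eq_mul, mul_one, mul_one,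
    measureReal_def, measureReal_def] at h
  exact (ENNReal.toReal_eq_toReal_iff' (measure_ne_top _ _) (measure_ne_top _ _)).1 h

/-- The location parameters in a convergence of types are bounded if the scales do not shrink. -/
theorem exists_subseq_tendsto_location {T : ℕ → Measure EReal} [∀ n, IsFiniteMeasure (T n)]
    {H H' : Measure EReal} [IsFiniteMeasure H] [IsFiniteMeasure H']
    (hH : NonDegenerate H) (hH' : NonDegenerate H') (htop : H {⊤} = 0) (htop' : H' {⊤} = 0)
    {A B : ℕ → ℝ} (hA : ∀ n, 0 < A n) {C : ℝ} (hC : Tendsto (fun n => (A n)⁻¹) atTop (𝓝 C))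
    (hT : ∀ g : EReal → ℝ, Continuous g → Tendsto (fun n => ∫ x, g x ∂(T n)) atTop
      (𝓝 (∫ x, g x ∂H)))
    (hT' : ∀ g : EReal → ℝ, Continuous g →
      Tendsto (fun n => ∫ x, g (standardize (A n) (B n) x) ∂(T n)) atTop (𝓝 (∫ x, g x ∂H'))) :
    ∃ (φ : ℕ → ℕ) (d : ℝ), StrictMono φ ∧
      Tendsto (fun n => -B (φ n) / A (φ n)) atTop (𝓝 d) ∧
      (C = 0 → H (range ((↑) : ℝ → EReal)) ≤ H' {(d : EReal)}) := by
  obtain ⟨D, φ, hφ, hD⟩ := CompactSpace.tendsto_subseq fun n => ((-B n / A n : ℝ) : EReal)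
  have hφT := hφ.tendsto_atTop
  have hA' : ∀ n, 0 < A (φ n) := fun n => hA _
  have hC' := hC.comp hφT
  have hTφ := fun g hg => (hT g hg).comp hφT
  have hTφ' := fun g hg => (hT' g hg).comp hφT
  have hcoe := tendsto_standardize_of_coe hA' (B := fun n => B (φ n)) hC' hD
  have hle := fun E (hE : IsOpen E) =>
    measure_le_singleton_of_tendsto (fun n => continuous_standardize (hA' n) (B (φ n)))
      hTφ hTφ' hE (D := D)
  induction D with
  | bot =>
    exfalso
    -- Everything except +∞, which `H` does not charge, would be sent to -∞, leaving `H'` no real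
    -- mass.
    have h1 : H {⊤}ᶜ ≤ H' {⊥} := by
      refine hle _ isOpen_compl_singleton fun x hx => ?_
      induction x with
      | bot => exact tendsto_standardize_bot_of_bot hA' (B := fun n => B (φ n)) hD
      | coe x =>
        have h := hcoe x
        rwa [EReal.add_bot] at h
      | top => exact absurd rfl hx
    have h2 : H {⊤}ᶜ = H univ := by
      rw [measure_compl (measurableSet_singleton _) (measure_ne_top _ _), htop, tsub_zero]
    have h3 : H' (range ((↑) : ℝ → EReal)) + H' {⊥} ≤ H' univ := by
      rw [← measure_union (by simp) (measurableSet_singleton _)]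
      exact measure_mono (subset_univ _)
    rw [h2, measure_univ_eq_of_tendsto hT hT'] at h1
    have h4 : H' {⊥} = H' univ := le_antisymm (measure_mono (subset_univ _)) h1
    rw [h4] at h3
    refine hH'.range_ne_zero ?_
    have h5 : H' (range ((↑) : ℝ → EReal)) + H' univ ≤ 0 + H' univ := by rwa [zero_add]
    exact le_antisymm ((ENNReal.add_le_add_iff_right (measure_ne_top _ _)).1 h5) zero_le
  | top =>
    exfalso
    -- All real mass of `H` would be sent to +∞, which `H'` does not charge.
    have h1 : H (range ((↑) : ℝ → EReal)) ≤ H' {⊤} := by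
      refine hle _ isOpen_range_coe ?_
      rintro _ ⟨x, rfl⟩
      have := hcoe x
      rwa [← EReal.coe_mul, EReal.coe_add_top] at this
    rw [htop'] at h1
    exact hH.range_ne_zero (le_antisymm h1 zero_le)
  | coe d =>
    refine ⟨φ, d, hφ, EReal.tendsto_coe.1 hD, fun hC0 => hle _ isOpen_range_coe ?_⟩
    rintro _ ⟨x, rfl⟩
    have h := hcoe x
    rwa [hC0, EReal.coe_zero, mul_zero, zero_add] at h

/-- Weak convergence tested against a continuously convergent family of functions. -/
theorem tendsto_integral_of_tendsto_prod {ι : Type*} {l : Filter ι} {T : ι → Measure EReal}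
    [∀ i, IsFiniteMeasure (T i)] {H : Measure EReal} [IsFiniteMeasure H]
    (hT : ∀ g : EReal → ℝ, Continuous g → Tendsto (fun i => ∫ x, g x ∂(T i)) l (𝓝 (∫ x, g x ∂H)))
    {h : ι → EReal → ℝ} {k : EReal → ℝ} (hh : ∀ᶠ i in l, Continuous (h i)) (hk : Continuous k)
    (hhk : ∀ x, Tendsto (fun p : ι × EReal => h p.1 p.2) (l ×ˢ 𝓝 x) (𝓝 (k x))) :
    Tendsto (fun i => ∫ x, h i x ∂(T i)) l (𝓝 (∫ x, k x ∂H)) := by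
  -- Continuous convergence on the compact space [-∞,∞] is uniform; the total masses stay bounded
  -- because 1 is a test function.
  have hunif : TendstoUniformly h k l := by
    rw [← tendstoLocallyUniformly_iff_tendstoUniformly_of_compactSpace,
      tendstoLocallyUniformly_iff_forall_tendsto]
    intro x
    rw [uniformity_eq_comap_nhds_zero, tendsto_comap_iff]
    have := (hhk x).sub ((hk.tendsto x).comp (tendsto_snd (f := l)))
    rwa [sub_self] at this
  have hmass : Tendsto (fun i => (T i).real univ) l (𝓝 (H.real univ)) := by
    simpa using hT _ (continuous_const (y := (1 : ℝ)))
  have hdiff : Tendsto (fun i => ∫ x, h i x ∂(T i) - ∫ x, k x ∂(T i)) l (𝓝 0) := by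
    rw [Metric.tendsto_nhds]
    intro ε hε
    have hm : 0 < H.real univ + 1 := by positivity
    filter_upwards [hmass.eventually_lt_const (lt_add_one _), hh,
      Metric.tendstoUniformly_iff.1 hunif (ε / (H.real univ + 1) / 2) (by positivity)]
      with i h1 h2 h3
    rw [dist_zero_right, ← integral_sub (integrable_of_continuous h2) (integrable_of_continuous hk)]
    calc ‖∫ x, (h i x - k x) ∂(T i)‖ ≤ ε / (H.real univ + 1) / 2 * (T i).real univ := by
          refine norm_integral_le_of_norm_le_const (ae_of_all _ fun x => ?_)
          rw [← dist_eq_norm, dist_comm]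
          exact (h3 x).le
      _ ≤ ε / (H.real univ + 1) / 2 * (H.real univ + 1) := by gcongr
      _ = ε / 2 := by field_simp
      _ < ε := by linarith
  simpa using hdiff.add (hT k hk)

/-- A convergent affine change of normalization transforms the limit accordingly. -/
theorem integral_comp_standardize_of_tendsto {T : ℕ → Measure EReal}
    [∀ n, IsFiniteMeasure (T n)] {H H' : Measure EReal} [IsFiniteMeasure H]
    {A B : ℕ → ℝ} {a b : ℝ} (ha : 0 < a)
    (hA : Tendsto A atTop (𝓝 a)) (hB : Tendsto B atTop (𝓝 b))
    (hT : ∀ g : EReal → ℝ, Continuous g → Tendsto (fun n => ∫ x, g x ∂(T n)) atTop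
      (𝓝 (∫ x, g x ∂H)))
    (hT' : ∀ g : EReal → ℝ, Continuous g →
      Tendsto (fun n => ∫ x, g (standardize (A n) (B n) x) ∂(T n)) atTop (𝓝 (∫ x, g x ∂H')))
    (g : EReal → ℝ) (hg : Continuous g) :
    ∫ x, g (standardize a b x) ∂H = ∫ x, g x ∂H' := by
  refine tendsto_nhds_unique (tendsto_integral_of_tendsto_prod hT ?_
    (hg.comp (continuous_standardize ha b)) fun x => ?_) (hT' g hg)
  · filter_upwards [hA.eventually_const_lt ha] with n hn
    exact hg.comp (continuous_standardize hn _)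
  · exact (hg.tendsto _).comp
      (tendsto_standardize ha (hA.comp tendsto_fst) (hB.comp tendsto_fst) tendsto_snd)

theorem tendsto_location_of_tendsto_scale {A B : ℕ → ℝ} {a d : ℝ} (hA : Tendsto A atTop (𝓝 a))
    (ha : a ≠ 0) (hd : Tendsto (fun n => -B n / A n) atTop (𝓝 d)) :
    Tendsto B atTop (𝓝 (-(d * a))) := by
  refine (hd.mul hA).neg.congr' ?_
  filter_upwards [hA.eventually_ne ha] with n hn
  field_simp

/-- Two normalizations of the same measures with the same non-degenerate limit have comparable
scales. -/
theorem not_tendsto_inv_scale_zero {T : ℕ → Measure EReal} [∀ n, IsFiniteMeasure (T n)]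
    {H : Measure EReal} [IsFiniteMeasure H] (hH : NonDegenerate H) (htop : H {⊤} = 0)
    {A B : ℕ → ℝ} (hA : ∀ n, 0 < A n)
    (hT : ∀ g : EReal → ℝ, Continuous g → Tendsto (fun n => ∫ x, g x ∂(T n)) atTop
      (𝓝 (∫ x, g x ∂H)))
    (hT' : ∀ g : EReal → ℝ, Continuous g →
      Tendsto (fun n => ∫ x, g (standardize (A n) (B n) x) ∂(T n)) atTop (𝓝 (∫ x, g x ∂H))) :
    ¬ Tendsto (fun n => (A n)⁻¹) atTop (𝓝 0) := by
  intro hC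
  obtain ⟨φ, d, -, -, h⟩ := exists_subseq_tendsto_location hH hH htop htop hA hC hT hT'
  -- As the inverse scales vanish, the atom at `d` would carry the whole real mass of `H`.
  refine hH d ?_
  rw [measure_sdiff (singleton_subset_iff.2 (mem_range_self d))
    (measurableSet_singleton _).nullMeasurableSet (measure_ne_top _ _)]
  exact tsub_eq_zero_of_le (h rfl)

/-- Along a subsequence the scales converge in [0,∞]. The value ∞ is excluded by
`not_tendsto_inv_scale_zero`, and 0 by exchanging the two normalizations. For a finite positive
limit the locations converge along a further subsequence, and the limiting map preserves `H`, hence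
is the identity. -/
theorem tendsto_one_zero_of_same_limit_of_pos {ι : Type*} {l : Filter ι} [l.IsCountablyGenerated]
    {T : ι → Measure EReal} [∀ i, IsFiniteMeasure (T i)]
    {H : Measure EReal} [IsFiniteMeasure H] (hH : NonDegenerate H) (htop : H {⊤} = 0)
    {A B : ι → ℝ} (hA : ∀ i, 0 < A i)
    (hT : ∀ g : EReal → ℝ, Continuous g → Tendsto (fun i => ∫ x, g x ∂(T i)) l (𝓝 (∫ x, g x ∂H)))
    (hT' : ∀ g : EReal → ℝ, Continuous g →
      Tendsto (fun i => ∫ x, g (standardize (A i) (B i) x) ∂(T i)) l (𝓝 (∫ x, g x ∂H))) :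
    Tendsto (fun i => (A i, B i)) l (𝓝 (1, 0)) := by
  refine tendsto_of_subseq_tendsto fun ns hns => ?_
  obtain ⟨a, φ, hφ, ha⟩ := CompactSpace.tendsto_subseq fun n => ((A (ns n) : ℝ) : EReal)
  have hφT := hns.comp hφ.tendsto_atTop
  have hTφ := fun g hg => (hT g hg).comp hφT
  have hTφ' := fun g hg => (hT' g hg).comp hφT
  have ha0 : 0 ≤ a := ge_of_tendsto' ha fun n => EReal.coe_nonneg.2 (hA _).le
  have hzero : ¬ Tendsto (fun n => A (ns (φ n))) atTop (𝓝 0) := by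
    intro h0
    have hcont : ∀ n, Continuous (standardize (A (ns (φ n))) (B (ns (φ n)))) := fun n =>
      continuous_standardize (hA _) _
    have hmap : ∀ (g : EReal → ℝ) (_ : Continuous g) (n : ℕ),
        ∫ x, g x ∂((T (ns (φ n))).map (standardize (A (ns (φ n))) (B (ns (φ n))))) =
          ∫ x, g (standardize (A (ns (φ n))) (B (ns (φ n))) x) ∂(T (ns (φ n))) := fun g hg n =>
      integral_map (hcont n).aemeasurable hg.aestronglyMeasurable
    -- The roles are exchanged: the image measures are the starting point, and the inverse affine
    -- maps lead back to `T`.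
    refine not_tendsto_inv_scale_zero
      (T := fun n => (T (ns (φ n))).map (standardize (A (ns (φ n))) (B (ns (φ n))))) hH htop
      (A := fun n => (A (ns (φ n)))⁻¹) (B := fun n => -B (ns (φ n)) / A (ns (φ n)))
      (fun n => inv_pos.2 (hA _)) (fun g hg => ?_) (fun g hg => ?_) (by simpa using h0)
    · exact (hTφ' g hg).congr fun n => (hmap g hg n).symm
    · refine (hTφ g hg).congr fun n => Eq.trans ?_ (hmap _ (hg.comp
        (continuous_standardize (inv_pos.2 (hA (ns (φ n))))
        (-B (ns (φ n)) / A (ns (φ n))))) n).symm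
      refine integral_congr_ae (ae_of_all _ fun x => ?_)
      have h0 : B (ns (φ n)) + A (ns (φ n)) * (-B (ns (φ n)) / A (ns (φ n))) = 0 := by
        have := (hA (ns (φ n))).ne'
        field_simp; ring
      simp only [Function.comp_apply]
      rw [standardize_standardize (hA _) (inv_pos.2 (hA _)), h0, mul_inv_cancel₀ (hA _).ne',
        standardize_one_zero]
  induction a with
  | bot => exact absurd ha0 (by simp)
  | top =>
    exfalso
    refine not_tendsto_inv_scale_zero hH htop (fun n => hA _) hTφ hTφ' ?_
    exact (EReal.tendsto_coe_nhds_top_iff.1 ha).inv_tendsto_atTop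
  | coe a =>
    have ha' : Tendsto (fun n => A (ns (φ n))) atTop (𝓝 a) := EReal.tendsto_coe.1 ha
    have ha0' : 0 < a := lt_of_le_of_ne (by exact_mod_cast ha0) fun h => hzero (h ▸ ha')
    obtain ⟨ψ, d, hψ, hd, -⟩ := exists_subseq_tendsto_location hH hH htop htop
      (fun n => hA (ns (φ n))) (ha'.inv₀ ha0'.ne') hTφ hTφ'
    have hψT := hψ.tendsto_atTop
    have hA' := ha'.comp hψT
    have hB' := tendsto_location_of_tendsto_scale hA' ha0'.ne' hd
    obtain ⟨h1, h2⟩ := eq_one_and_eq_zero_of_integral_comp_standardize hH ha0'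
      (integral_comp_standardize_of_tendsto ha0' hA' hB' (fun g hg => (hTφ g hg).comp hψT)
        (fun g hg => (hTφ' g hg).comp hψT))
    refine ⟨φ ∘ ψ, ?_⟩
    have h := hA'.prodMk_nhds hB'
    rw [h2, h1] at h
    exact h

/-- The bounds on the scales are hypotheses since `H` and `H'` may differ: mass at -∞ in one limit
can become real mass in the other at an incomparable scale. -/
theorem exists_subseq_tendsto_of_scale_bounded {T : ℕ → Measure EReal}
    [∀ n, IsFiniteMeasure (T n)]
    {H H' : Measure EReal} [IsFiniteMeasure H] [IsFiniteMeasure H']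
    (hH : NonDegenerate H) (hH' : NonDegenerate H') (htop : H {⊤} = 0) (htop' : H' {⊤} = 0)
    {A B : ℕ → ℝ} (hA : ∀ n, 0 < A n) {m M : ℝ} (hm : 0 < m)
    (hmM : ∀ᶠ n in atTop, A n ∈ Icc m M)
    (hT : ∀ g : EReal → ℝ, Continuous g → Tendsto (fun n => ∫ x, g x ∂(T n)) atTop
      (𝓝 (∫ x, g x ∂H)))
    (hT' : ∀ g : EReal → ℝ, Continuous g →
      Tendsto (fun n => ∫ x, g (standardize (A n) (B n) x) ∂(T n)) atTop (𝓝 (∫ x, g x ∂H'))) :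
    ∃ (φ : ℕ → ℕ) (a b : ℝ), StrictMono φ ∧ 0 < a ∧ Tendsto (A ∘ φ) atTop (𝓝 a) ∧
      Tendsto (B ∘ φ) atTop (𝓝 b) ∧
      ∀ g : EReal → ℝ, Continuous g → ∫ x, g (standardize a b x) ∂H = ∫ x, g x ∂H' := by
  obtain ⟨a, haI, φ, hφ, ha⟩ := isCompact_Icc.tendsto_subseq' hmM.frequently
  have ha0 : 0 < a := hm.trans_le haI.1
  have hφT := hφ.tendsto_atTop
  obtain ⟨ψ, d, hψ, hd, -⟩ := exists_subseq_tendsto_location hH hH' htop htop'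
    (fun n => hA (φ n)) (ha.inv₀ ha0.ne') (fun g hg => (hT g hg).comp hφT)
    (fun g hg => (hT' g hg).comp hφT)
  have hψT := hφT.comp hψ.tendsto_atTop
  have hA' := ha.comp hψ.tendsto_atTop
  have hB' := tendsto_location_of_tendsto_scale hA' ha0.ne' hd
  exact ⟨φ ∘ ψ, a, _, hφ.comp hψ, ha0, hA', hB',
    integral_comp_standardize_of_tendsto ha0 hA' hB' (fun g hg => (hT g hg).comp hψT)
        (fun g hg => (hT' g hg).comp hψT)⟩

/-- All subsequential limits are affine maps carrying `H` to `H'`, and by `standardize_unique` there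
is only one. -/
theorem exists_tendsto_of_scale_bounded_of_pos {ι : Type*} {l : Filter ι} [l.IsCountablyGenerated]
    [l.NeBot] {T : ι → Measure EReal} [∀ i, IsFiniteMeasure (T i)]
    {H H' : Measure EReal} [IsFiniteMeasure H] [IsFiniteMeasure H']
    (hH : NonDegenerate H) (hH' : NonDegenerate H') (htop : H {⊤} = 0) (htop' : H' {⊤} = 0)
    {A B : ι → ℝ} (hA : ∀ i, 0 < A i) {m M : ℝ} (hm : 0 < m) (hmM : ∀ᶠ i in l, A i ∈ Icc m M)
    (hT : ∀ g : EReal → ℝ, Continuous g → Tendsto (fun i => ∫ x, g x ∂(T i)) l (𝓝 (∫ x, g x ∂H)))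
    (hT' : ∀ g : EReal → ℝ, Continuous g →
      Tendsto (fun i => ∫ x, g (standardize (A i) (B i) x) ∂(T i)) l (𝓝 (∫ x, g x ∂H'))) :
    ∃ a b : ℝ, 0 < a ∧ Tendsto A l (𝓝 a) ∧ Tendsto B l (𝓝 b) := by
  have key : ∀ ns : ℕ → ι, Tendsto ns atTop l → ∃ (φ : ℕ → ℕ) (a b : ℝ), StrictMono φ ∧ 0 < a ∧
      Tendsto ((A ∘ ns) ∘ φ) atTop (𝓝 a) ∧ Tendsto ((B ∘ ns) ∘ φ) atTop (𝓝 b) ∧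
      ∀ g : EReal → ℝ, Continuous g → ∫ x, g (standardize a b x) ∂H = ∫ x, g x ∂H' :=
    fun ns hns => exists_subseq_tendsto_of_scale_bounded hH hH' htop htop' (fun n => hA (ns n)) hm
      (hns.eventually hmM) (fun g hg => (hT g hg).comp hns) (fun g hg => (hT' g hg).comp hns)
  obtain ⟨ns₀, hns₀⟩ := exists_seq_tendsto l
  obtain ⟨-, a, b, -, ha, -, -, hab⟩ := key ns₀ hns₀
  have : Tendsto (fun i => (A i, B i)) l (𝓝 (a, b)) := by
    refine tendsto_of_subseq_tendsto fun ns hns => ?_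
    obtain ⟨φ, a', b', -, ha', hA', hB', hab'⟩ := key ns hns
    obtain ⟨rfl, rfl⟩ := standardize_unique hH ha ha' hab hab'
    exact ⟨φ, hA'.prodMk_nhds hB'⟩
  exact ⟨a, b, ha, (continuous_fst.tendsto _).comp this, (continuous_snd.tendsto _).comp this⟩

/-- Two normalizations of the same measures with the same non-degenerate limit are
asymptotically equal. -/
theorem tendsto_one_zero_of_same_limit {ι : Type*} {l : Filter ι} [l.IsCountablyGenerated]
    {T : ι → Measure EReal} [∀ i, IsFiniteMeasure (T i)]
    {H : Measure EReal} [IsFiniteMeasure H] (hH : NonDegenerate H) (htop : H {⊤} = 0)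
    {A B : ι → ℝ} (hA : ∀ᶠ i in l, 0 < A i)
    (hT : ∀ g : EReal → ℝ, Continuous g → Tendsto (fun i => ∫ x, g x ∂(T i)) l (𝓝 (∫ x, g x ∂H)))
    (hT' : ∀ g : EReal → ℝ, Continuous g →
      Tendsto (fun i => ∫ x, g (standardize (A i) (B i) x) ∂(T i)) l (𝓝 (∫ x, g x ∂H))) :
    Tendsto (fun i => (A i, B i)) l (𝓝 (1, 0)) := by
  -- Scales that are not positive are replaced by 1; this does not affect the limit along `l`.
  have hAe : ∀ᶠ i in l, (if 0 < A i then A i else 1) = A i := hA.mono fun i hi => if_pos hi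
  refine (tendsto_one_zero_of_same_limit_of_pos hH htop (A := fun i => if 0 < A i then A i else 1)
    (B := B) (fun i => by split_ifs <;> simp_all) hT fun g hg => ?_).congr' ?_
  · refine (hT' g hg).congr' ?_
    filter_upwards [hAe] with i hi
    rw [hi]
  · filter_upwards [hAe] with i hi
    rw [hi]

/-- Convergence of types on the extended real line, for scales that are bounded and bounded away
from zero. -/
theorem exists_tendsto_of_scale_bounded {ι : Type*} {l : Filter ι} [l.IsCountablyGenerated]
    [l.NeBot] {T : ι → Measure EReal} [∀ i, IsFiniteMeasure (T i)]
    {H H' : Measure EReal} [IsFiniteMeasure H] [IsFiniteMeasure H']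
    (hH : NonDegenerate H) (hH' : NonDegenerate H') (htop : H {⊤} = 0) (htop' : H' {⊤} = 0)
    {A B : ι → ℝ} {m M : ℝ} (hm : 0 < m) (hmM : ∀ᶠ i in l, A i ∈ Icc m M)
    (hT : ∀ g : EReal → ℝ, Continuous g → Tendsto (fun i => ∫ x, g x ∂(T i)) l (𝓝 (∫ x, g x ∂H)))
    (hT' : ∀ g : EReal → ℝ, Continuous g →
      Tendsto (fun i => ∫ x, g (standardize (A i) (B i) x) ∂(T i)) l (𝓝 (∫ x, g x ∂H'))) :
    ∃ a b : ℝ, 0 < a ∧ Tendsto A l (𝓝 a) ∧ Tendsto B l (𝓝 b) := by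
  have hAe : ∀ᶠ i in l, (if 0 < A i then A i else 1) = A i :=
    hmM.mono fun i hi => if_pos (hm.trans_le hi.1)
  obtain ⟨a, b, ha, hAa, hBb⟩ := exists_tendsto_of_scale_bounded_of_pos hH hH' htop htop'
    (A := fun i => if 0 < A i then A i else 1) (B := B)
    (fun i => by split_ifs <;> simp_all) hm (M := M)
    (by filter_upwards [hmM, hAe] with i h1 h2; rwa [h2]) hT fun g hg => by
      refine (hT' g hg).congr' ?_
      filter_upwards [hAe] with i hi
      rw [hi]
  exact ⟨a, b, ha, hAa.congr' hAe, hBb⟩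

/-! ### Weights in the second coordinate and weighted marginals -/

/-- The continuous function that is `0` below `1`, `1` above `2`, and linear in between. -/
def ramp (e : EReal) : ℝ := (max 1 (min 2 e)).toReal - 1

theorem continuous_ramp : Continuous ramp := by
  refine Continuous.sub ?_ continuous_const
  refine EReal.continuousOn_toReal.comp_continuous (by fun_prop) fun e => ?_
  have h1 : (1 : EReal) ≤ max 1 (min 2 e) := le_max_left _ _
  have h2 : max 1 (min 2 e) ≤ (2 : EReal) :=
    max_le (by exact_mod_cast one_le_two) (min_le_left _ _)
  simp only [mem_compl_iff, mem_insert_iff, mem_singleton_iff, not_or]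
  constructor
  · intro h
    rw [h] at h1
    exact absurd h1 (by exact_mod_cast not_le.2 (EReal.bot_lt_coe 1))
  · intro h
    rw [h] at h2
    exact absurd h2 (by exact_mod_cast not_le.2 (EReal.coe_lt_top 2))

theorem ramp_coe (v : ℝ) : ramp v = max 1 (min 2 v) - 1 := by
  have : (max 1 (min 2 (v : EReal))) = ((max 1 (min 2 v) : ℝ) : EReal) := by
    rw [EReal.coe_strictMono.monotone.map_max, EReal.coe_strictMono.monotone.map_min]
    rfl
  rw [ramp, this, EReal.toReal_coe]

theorem ramp_of_le_one {e : EReal} (he : e ≤ 1) : ramp e = 0 := by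
  rw [ramp, max_eq_left ((min_le_right _ _).trans he)]
  simp

theorem ramp_of_two_le {e : EReal} (he : 2 ≤ e) : ramp e = 1 := by
  have h : (2 : EReal) = ((2 : ℝ) : EReal) := rfl
  have h' : max 1 (2 : EReal) = 2 := max_eq_right (by exact_mod_cast one_le_two)
  rw [ramp, min_eq_left he, h', h, EReal.toReal_coe]
  norm_num

theorem ramp_mem_Icc (e : EReal) : ramp e ∈ Icc 0 1 := by
  induction e with
  | bot => rw [ramp_of_le_one bot_le]; simp
  | top => rw [ramp_of_two_le le_top]; simp
  | coe x =>
    rw [ramp_coe]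
    constructor
    · linarith [le_max_left 1 (min 2 x)]
    · linarith [max_le one_le_two (min_le_left 2 x)]

/-- The cost of replacing the weight t φ(Y/t) by tc φ(Y/(tc)). The prefactor contributes |c-1|. The
ramp is 1-Lipschitz, giving u|c⁻¹-1| for u ≤ 4; for u ≥ 4 both ramps equal 1, and for u ≤ 1/2 both
vanish because c ≥ 1/2. -/
theorem abs_mul_ramp_sub_le {c u : ℝ} (hc : c ∈ Icc (1 / 2 : ℝ) 2) :
    |c * ramp ((u / c : ℝ) : EReal) - ramp (u : EReal)| ≤
      if 1 / 2 < u then |c - 1| + 4 * |c⁻¹ - 1| else 0 := by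
  have hc0 : 0 < c := by linarith [hc.1]
  split_ifs with hu
  · have h1 : |c * ramp ((u / c : ℝ) : EReal) - ramp ((u / c : ℝ) : EReal)| ≤ |c - 1| := by
      have : c * ramp ((u / c : ℝ) : EReal) - ramp ((u / c : ℝ) : EReal) =
        (c - 1) * ramp ((u / c : ℝ) : EReal) := by ring
      rw [this, abs_mul, abs_of_nonneg (ramp_mem_Icc _).1]
      exact mul_le_of_le_one_right (abs_nonneg _) (ramp_mem_Icc _).2
    have h2 : |ramp ((u / c : ℝ) : EReal) - ramp (u : EReal)| ≤ 4 * |c⁻¹ - 1| := by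
      rw [ramp_coe, ramp_coe]
      rcases le_total u 4 with h4 | h4
      · calc |max 1 (min 2 (u / c)) - 1 - (max 1 (min 2 u) - 1)|
            = |max 1 (min 2 (u / c)) - max 1 (min 2 u)| := by ring_nf
          _ ≤ |min 2 (u / c) - min 2 u| := by
            simpa using abs_max_sub_max_le_max 1 (min 2 (u / c)) 1 (min 2 u)
          _ ≤ |u / c - u| := by
            simpa using abs_min_sub_min_le_max 2 (u / c) 2 u
          _ = u * |c⁻¹ - 1| := by
            have h5 : u / c - u = u * (c⁻¹ - 1) := by ring
            rw [h5, abs_mul, abs_of_pos (by linarith : 0 < u)]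
          _ ≤ 4 * |c⁻¹ - 1| := by gcongr
      · have h5 : 2 ≤ u / c := by
          rw [le_div_iff₀ hc0]; linarith [hc.2]
        rw [min_eq_left h5, min_eq_left (by linarith), sub_self, abs_zero]
        positivity
    calc _ = |(c * ramp ((u / c : ℝ) : EReal) - ramp ((u / c : ℝ) : EReal)) +
          (ramp ((u / c : ℝ) : EReal) - ramp (u : EReal))| := by congr 1; ring
      _ ≤ _ := (abs_add_le _ _).trans (add_le_add h1 h2)
  · have h1 : u / c ≤ 1 := by
      rw [div_le_one hc0]; linarith [hc.1]
    rw [ramp_of_le_one (by exact_mod_cast h1),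
      ramp_of_le_one (by exact_mod_cast (by linarith : u ≤ 1))]
    simp

/-- Restricting to the cone loses nothing, as `f` vanishes where the second coordinate is not
positive. -/
theorem integral_scaledLaw {Ω : Type*} [MeasurableSpace Ω] (P : Measure Ω) {X Y : Ω → ℝ}
    (hX : Measurable X) (hY : Measurable Y) (α β : ℝ → ℝ) {t : ℝ} (ht : 0 ≤ t)
    {f : EReal × EReal → ℝ} (hf : Measurable f) (hf0 : ∀ p : EReal × EReal, p.2 ≤ 0 → f p = 0) :
    ∫ p : Cone, f (p.1, p.2) ∂(scaledLaw P X Y α β t) =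
      t * ∫ ω, f (standardize (α t) (β t) (X ω), ((Y ω / t : ℝ) : EReal)) ∂P := by
  have hm : Measurable
      (fun ω => ((((X ω - β t) / α t : ℝ) : EReal), ((Y ω / t : ℝ) : EReal))) := by
    fun_prop
  rw [scaledLaw, integral_smul_measure, ENNReal.toReal_ofReal ht, smul_eq_mul]
  congr 1
  have h1 := measurableEmbedding_cone.integral_map (μ := (P.map
    (fun ω => ((((X ω - β t) / α t : ℝ) : EReal), ((Y ω / t : ℝ) : EReal)))).comap
      (Prod.map id Subtype.val)) f
  rw [measurableEmbedding_cone.map_comap, setIntegral_eq_integral_of_forall_compl_eq_zero,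
    integral_map hm.aemeasurable hf.aestronglyMeasurable] at h1
  · simp_rw [standardize_coe]
    exact h1.symm
  · rintro ⟨x, y⟩ hp
    refine hf0 _ (not_lt.1 fun hy => hp ⟨(x, ⟨y, hy⟩), rfl⟩)

/-- The law of the standardized first component, weighted by a function of the second one. -/
def weightedLaw {Ω : Type*} [MeasurableSpace Ω] (P : Measure Ω) (X Y : Ω → ℝ) (φ : EReal → ℝ)
    (a b t : ℝ) : Measure EReal :=
  (ENNReal.ofReal t • P.withDensity fun ω => ENNReal.ofReal (φ ((Y ω / t : ℝ) : EReal))).map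
    fun ω => standardize a b (X ω)

/-- The first marginal of a measure on the cone, weighted by a function of the second
component. -/
def weightedMarginal (μ : Measure Cone) (φ : EReal → ℝ) : Measure EReal :=
  (μ.withDensity fun p => ENNReal.ofReal (φ p.2)).map Prod.fst

/-- Continuous weights on `[-∞, ∞]` with values in `[0, 1]` that vanish up to `δ > 0` and equal `1`
from some point on. -/
structure IsWeight (φ : EReal → ℝ) (δ M : ℝ) : Prop where
  continuous : Continuous φ
  mem_Icc : ∀ e, φ e ∈ Icc (0 : ℝ) 1
  pos : 0 < δ
  eq_zero : ∀ e : EReal, e ≤ δ → φ e = 0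
  eq_one : ∀ e : EReal, M < e → φ e = 1

theorem isWeight_ramp : IsWeight ramp 1 2 where
  continuous := continuous_ramp
  mem_Icc := ramp_mem_Icc
  pos := one_pos
  eq_zero _ he := ramp_of_le_one he
  eq_one _ he := ramp_of_two_le he.le

/-- The function is e ↦ ramp(c e): at Y/(tc) it takes the value of `ramp` at Y/t, so the same weight
on `P` can be read at time tc. -/
theorem isWeight_ramp_mul {c : ℝ} (hc : 0 < c) :
    IsWeight (fun e => ramp (standardize c⁻¹ 0 e)) c⁻¹ (2 * c⁻¹) where
  continuous := continuous_ramp.comp (continuous_standardize (inv_pos.2 hc) 0)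
  mem_Icc _ := ramp_mem_Icc _
  pos := inv_pos.2 hc
  eq_zero e he := by
    refine ramp_of_le_one ?_
    induction e with
    | bot => rw [standardize_bot (inv_pos.2 hc)]; exact bot_le
    | top => exact absurd he (not_le.2 (EReal.coe_lt_top _))
    | coe x =>
      rw [standardize_coe, sub_zero]
      have := EReal.coe_le_coe_iff.1 he
      exact_mod_cast (div_le_one (inv_pos.2 hc)).2 this
  eq_one e he := by
    refine ramp_of_two_le ?_
    induction e with
    | bot => exact absurd he not_lt_bot
    | top => rw [standardize_top (inv_pos.2 hc)]; exact le_top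
    | coe x =>
      rw [standardize_coe, sub_zero]
      have := EReal.coe_lt_coe_iff.1 he
      exact EReal.coe_le_coe_iff.2 ((le_div_iff₀ (inv_pos.2 hc)).2 this.le)

section weighted

variable {Ω : Type*} [MeasurableSpace Ω] {P : Measure Ω}
  {X Y : Ω → ℝ} {φ : EReal → ℝ} {δ M : ℝ}

theorem isFiniteMeasure_weightedLaw [IsProbabilityMeasure P] (hφ : IsWeight φ δ M) (a b t : ℝ) :
    IsFiniteMeasure (weightedLaw P X Y φ a b t) := by
  have h : IsFiniteMeasure
      (P.withDensity fun ω => ENNReal.ofReal (φ ((Y ω / t : ℝ) : EReal))) := by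
    refine isFiniteMeasure_withDensity (ne_top_of_le_ne_top (b := 1) ENNReal.one_ne_top ?_)
    calc ∫⁻ ω, ENNReal.ofReal (φ ((Y ω / t : ℝ) : EReal)) ∂P ≤ ∫⁻ _, 1 ∂P :=
          lintegral_mono fun ω => ENNReal.ofReal_le_one.2 (hφ.mem_Icc _).2
      _ = 1 := by simp
  have := Measure.smul_finite (P.withDensity fun ω => ENNReal.ofReal (φ ((Y ω / t : ℝ) : EReal)))
    (ENNReal.ofReal_ne_top (r := t))
  unfold weightedLaw
  infer_instance

theorem integral_weightedLaw (hX : Measurable X) (hY : Measurable Y) (hφ : IsWeight φ δ M)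
    (a b : ℝ) {t : ℝ} (ht : 0 ≤ t) {g : EReal → ℝ} (hg : Continuous g) :
    ∫ x, g x ∂(weightedLaw P X Y φ a b t) =
      t * ∫ ω, g (standardize a b (X ω)) * φ ((Y ω / t : ℝ) : EReal) ∂P := by
  have hm : Measurable fun ω => standardize a b (X ω) :=
    (measurable_standardize a b).comp hX.coe_real_ereal
  have hm' : Measurable fun ω => ENNReal.ofReal (φ ((Y ω / t : ℝ) : EReal)) :=
    ENNReal.measurable_ofReal.comp (hφ.continuous.measurable.comp (by fun_prop))
  rw [weightedLaw, integral_map hm.aemeasurable hg.aestronglyMeasurable, integral_smul_measure,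
    ENNReal.toReal_ofReal ht, smul_eq_mul,
    integral_withDensity_eq_integral_toReal_smul hm' (ae_of_all _ fun _ => ENNReal.ofReal_lt_top)]
  congr 2 with ω
  rw [ENNReal.toReal_ofReal (hφ.mem_Icc _).1, smul_eq_mul, mul_comm]

theorem integral_weightedMarginal {μ : Measure Cone} (hφ : IsWeight φ δ M) {g : EReal → ℝ}
    (hg : Continuous g) :
    ∫ x, g x ∂(weightedMarginal μ φ) = ∫ p : Cone, g p.1 * φ p.2 ∂μ := by
  have hm' : Measurable fun p : Cone => ENNReal.ofReal (φ p.2) :=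
    ENNReal.measurable_ofReal.comp (hφ.continuous.measurable.comp (by fun_prop))
  rw [weightedMarginal, integral_map measurable_fst.aemeasurable hg.aestronglyMeasurable,
    integral_withDensity_eq_integral_toReal_smul hm' (ae_of_all _ fun _ => ENNReal.ofReal_lt_top)]
  congr 1 with p
  rw [ENNReal.toReal_ofReal (hφ.mem_Icc _).1, smul_eq_mul, mul_comm]

/-- The endpoint +∞ belongs to the second factor, so staying away from 0 suffices for compactness.
-/
theorem isCompact_cone_ge {δ : ℝ} (hδ : 0 < δ) : IsCompact {p : Cone | (δ : EReal) ≤ p.2} := by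
  have h : IsCompact {y : Ioi (0 : EReal) | (δ : EReal) ≤ y} := by
    rw [Subtype.isCompact_iff]
    have : ((↑) : Ioi (0 : EReal) → EReal) '' {y | (δ : EReal) ≤ y} = Ici (δ : EReal) := by
      ext y
      simp only [mem_image, mem_ofPred_eq, Subtype.exists, mem_Ioi, exists_and_left, exists_prop,
        exists_eq_right_right, mem_Ici]
      exact ⟨fun h => h.1, fun h => ⟨h, (EReal.coe_pos.2 hδ).trans_le h⟩⟩
    rw [this]
    exact isClosed_Ici.isCompact
  have h2 : {p : Cone | (δ : EReal) ≤ p.2} = univ ×ˢ {y : Ioi (0 : EReal) | (δ : EReal) ≤ y} := by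
    ext p; simp
  rw [h2]
  exact isCompact_univ.prod h

theorem isFiniteMeasure_weightedMarginal {μ : Measure Cone} [IsFiniteMeasureOnCompacts μ]
    (hφ : IsWeight φ δ M) : IsFiniteMeasure (weightedMarginal μ φ) := by
  have hK := isCompact_cone_ge hφ.pos
  have h : IsFiniteMeasure (μ.withDensity fun p => ENNReal.ofReal (φ p.2)) := by
    refine isFiniteMeasure_withDensity (ne_top_of_le_ne_top (hK.measure_lt_top (μ := μ)).ne ?_)
    rw [← lintegral_indicator_one hK.measurableSet]
    refine lintegral_mono fun p => ?_
    by_cases hp : (δ : EReal) ≤ p.2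
    · rw [indicator_of_mem (show p ∈ {p : Cone | (δ : EReal) ≤ p.2} from hp)]
      exact ENNReal.ofReal_le_one.2 (hφ.mem_Icc _).2
    · rw [hφ.eq_zero _ (not_le.1 hp).le]
      simp
  unfold weightedMarginal
  infer_instance

theorem measurableSet_cone_gt (y : ℝ) : MeasurableSet {p : Cone | (y : EReal) < (p.2 : EReal)} :=
  measurableSet_lt measurable_const (measurable_subtype_coe.comp measurable_snd)

/-- With `weightedMarginal_le_slice` this sandwiches the weighted marginal between two slices: it
inherits non-degeneracy from the smaller one and the absence of mass at +∞ from the larger one. -/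
theorem slice_le_weightedMarginal {μ : Measure Cone} (hφ : IsWeight φ δ M) {A : Set EReal}
    (hA : MeasurableSet A) : slice μ M A ≤ weightedMarginal μ φ A := by
  rw [slice, weightedMarginal, Measure.map_apply measurable_fst hA,
    Measure.map_apply measurable_fst hA, withDensity_apply _ (measurable_fst hA),
    Measure.restrict_apply (measurable_fst hA),
    ← setLIntegral_one]
  calc ∫⁻ _ in Prod.fst ⁻¹' A ∩ {p : Cone | (M : EReal) < p.2}, 1 ∂μ
      = ∫⁻ p in Prod.fst ⁻¹' A ∩ {p : Cone | (M : EReal) < p.2}, ENNReal.ofReal (φ p.2) ∂μ := by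
        refine setLIntegral_congr_fun ((measurable_fst hA).inter (measurableSet_cone_gt M)) ?_
        intro p hp
        simp only
        rw [hφ.eq_one _ hp.2, ENNReal.ofReal_one]
    _ ≤ _ := lintegral_mono_set inter_subset_left

theorem weightedMarginal_le_slice {μ : Measure Cone} (hφ : IsWeight φ δ M) {A : Set EReal}
    (hA : MeasurableSet A) : weightedMarginal μ φ A ≤ slice μ δ A := by
  rw [slice, weightedMarginal, Measure.map_apply measurable_fst hA,
    Measure.map_apply measurable_fst hA, withDensity_apply _ (measurable_fst hA),
    Measure.restrict_apply (measurable_fst hA), inter_comm,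
    ← Measure.restrict_apply (measurableSet_cone_gt δ),
    ← lintegral_indicator_one (measurableSet_cone_gt δ)]
  refine lintegral_mono fun p => ?_
  by_cases hp : (δ : EReal) < p.2
  · rw [indicator_of_mem (show p ∈ {p : Cone | (δ : EReal) < p.2} from hp)]
    exact ENNReal.ofReal_le_one.2 (hφ.mem_Icc _).2
  · rw [hφ.eq_zero _ (not_lt.1 hp)]
    simp

theorem measurableSet_range_diff (c : ℝ) :
    MeasurableSet (range ((↑) : ℝ → EReal) \ {(c : EReal)}) :=
  isOpen_range_coe.measurableSet.diff (measurableSet_singleton _)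

theorem nonDegenerate_weightedMarginal {μ : Measure Cone} (hμ : CondNonDegenerate μ)
    (hφ : IsWeight φ δ M) (hM : 0 < M) : NonDegenerate (weightedMarginal μ φ) := fun c h =>
  (hμ M hM).1 c (le_antisymm
    ((slice_le_weightedMarginal hφ (measurableSet_range_diff c)).trans h.le) zero_le)

theorem weightedMarginal_top {μ : Measure Cone} (hμ : CondNonDegenerate μ)
    (hφ : IsWeight φ δ M) : weightedMarginal μ φ {⊤} = 0 :=
  le_antisymm ((weightedMarginal_le_slice hφ (measurableSet_singleton _)).trans
    (hμ δ hφ.pos).2.le) zero_le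

/-- The product of `g` and φ is an admissible test function: its support lies over [δ,∞]. -/
theorem tendsto_integral_weight {α β : ℝ → ℝ} {μ : Measure Cone} (hX : Measurable X)
    (hY : Measurable Y) (hμ : VagueTendsto (scaledLaw P X Y α β) μ) (hφ : IsWeight φ δ M)
    {g : EReal → ℝ} (hg : Continuous g) :
    Tendsto (fun t => t * ∫ ω, g (standardize (α t) (β t) (X ω)) * φ ((Y ω / t : ℝ) : EReal) ∂P)
      atTop (𝓝 (∫ x, g x ∂(weightedMarginal μ φ))) := by
  rw [integral_weightedMarginal hφ hg]
  have h := hμ (fun p => g p.1 * φ p.2)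
    ((hg.comp continuous_fst).mul (hφ.continuous.comp (by fun_prop)))
    (HasCompactSupport.intro (isCompact_cone_ge hφ.pos) fun p hp => by
      rw [hφ.eq_zero _ (not_le.1 hp).le, mul_zero])
  refine h.congr' ?_
  filter_upwards [eventually_ge_atTop 0] with t ht
  exact integral_scaledLaw P hX hY α β ht (f := fun p => g p.1 * φ p.2)
    ((hg.measurable.comp measurable_fst).mul (hφ.continuous.measurable.comp measurable_snd))
    fun p hp => by
      rw [hφ.eq_zero _ (hp.trans (EReal.coe_nonneg.2 hφ.pos.le)), mul_zero]

end weighted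

/-! ### From a vague limit to convergent ratios -/

/-- The link to regular variation: with normalizations taken at t and tc, the connecting parameters
are the two ratios in `ERV`. -/
theorem standardize_standardize_ratio {a a' : ℝ} (ha : 0 < a) (ha' : 0 < a') (b b' : ℝ)
    (e : EReal) :
    standardize (a' / a) ((b' - b) / a) (standardize a b e) = standardize a' b' e := by
  rw [standardize_standardize ha (div_pos ha' ha)]
  congr 1
  · field_simp
  · field_simp; ring

/-- The ratios in the definition of extended regular variation converge to those of the identity
as the argument tends to `1`, jointly with `t → ∞`. -/
def SlowlyVaryingNearOne (α β : ℝ → ℝ) : Prop :=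
  Tendsto (fun p : ℝ × ℝ => (α (p.1 * p.2) / α p.1, (β (p.1 * p.2) - β p.1) / α p.1))
    (atTop ×ˢ 𝓝 1) (𝓝 (1, 0))

section limit

variable {Ω : Type*} [MeasurableSpace Ω] {P : Measure Ω} [IsProbabilityMeasure P]
  {X Y : Ω → ℝ} {α β : ℝ → ℝ}

theorem tendsto_fst_mul_snd {c : ℝ} (hc : 0 < c) :
    Tendsto (fun p : ℝ × ℝ => p.1 * p.2) (atTop ×ˢ 𝓝 c) atTop :=
  tendsto_fst.atTop_mul_pos hc tendsto_snd

theorem integrable_comp_standardize (hX : Measurable X) {g : EReal → ℝ}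
    (hg : Continuous g) (a b : ℝ) {w : Ω → ℝ} (hw : Measurable w) (hw1 : ∀ ω, |w ω| ≤ 1) :
    Integrable (fun ω => g (standardize a b (X ω)) * w ω) P := by
  obtain ⟨C, hC⟩ := isCompact_univ.exists_bound_of_continuousOn (f := g) hg.continuousOn
  refine Integrable.of_bound (C := C * 1) ?_ (ae_of_all _ fun ω => ?_)
  · exact ((hg.measurable.comp ((measurable_standardize a b).comp hX.coe_real_ereal)).mul
      hw).aestronglyMeasurable
  · rw [norm_mul]
    gcongr
    · exact (norm_nonneg _).trans (hC ⊤ (mem_univ _))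
    · exact hC _ (mem_univ _)
    · exact hw1 ω

/-- The last factor converges as t → ∞ by the domain of attraction hypothesis, so the bound vanishes
as c → 1. It is uniform in the affine parameters, which may thus be those at tc. -/
theorem abs_integral_ramp_sub_le (hX : Measurable X) (hY : Measurable Y) {g : EReal → ℝ}
    (hg : Continuous g) {C : ℝ} (hC : ∀ x, ‖g x‖ ≤ C) (a b : ℝ) {t c : ℝ} (ht : 0 < t)
    (hc : c ∈ Icc (1 / 2 : ℝ) 2) :
    |t * c * ∫ ω, g (standardize a b (X ω)) * ramp ((Y ω / (t * c) : ℝ) : EReal) ∂P -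
      t * ∫ ω, g (standardize a b (X ω)) * ramp ((Y ω / t : ℝ) : EReal) ∂P| ≤
      C * (|c - 1| + 4 * |c⁻¹ - 1|) * (t * P.real {ω | t * (1 / 2) < Y ω}) := by
  have hmeas : ∀ s : ℝ, Measurable fun ω => ramp ((Y ω / s : ℝ) : EReal) := fun s =>
    continuous_ramp.measurable.comp (by fun_prop)
  have hle : ∀ s ω, |ramp ((Y ω / s : ℝ) : EReal)| ≤ 1 := fun s ω => by
    rw [abs_of_nonneg (ramp_mem_Icc _).1]
    exact (ramp_mem_Icc _).2
  have hi : ∀ s : ℝ, Integrable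
      (fun ω => g (standardize a b (X ω)) * ramp ((Y ω / s : ℝ) : EReal)) P := fun s =>
    integrable_comp_standardize hX hg a b (hmeas s) (hle s)
  have hset : MeasurableSet {ω | t * (1 / 2) < Y ω} := measurableSet_lt measurable_const hY
  rw [mul_assoc, ← mul_sub, abs_mul, abs_of_pos ht, ← integral_const_mul,
    ← integral_sub ((hi _).const_mul _) (hi _)]
  have h1 : |∫ ω, (c * (g (standardize a b (X ω)) * ramp ((Y ω / (t * c) : ℝ) : EReal)) -
      g (standardize a b (X ω)) * ramp ((Y ω / t : ℝ) : EReal)) ∂P| ≤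
      ∫ ω, {ω | t * (1 / 2) < Y ω}.indicator (fun _ => C * (|c - 1| + 4 * |c⁻¹ - 1|)) ω ∂P := by
    have hint : Integrable ({ω | t * (1 / 2) < Y ω}.indicator fun _ =>
        C * (|c - 1| + 4 * |c⁻¹ - 1|)) P := (integrable_const _).indicator hset
    rw [← Real.norm_eq_abs]
    refine norm_integral_le_of_norm_le hint (ae_of_all _ fun ω => ?_)
    have h2 := abs_mul_ramp_sub_le (u := Y ω / t) hc
    have h3 : c * (g (standardize a b (X ω)) * ramp ((Y ω / (t * c) : ℝ) : EReal)) -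
        g (standardize a b (X ω)) * ramp ((Y ω / t : ℝ) : EReal) =
        g (standardize a b (X ω)) *
          (c * ramp ((Y ω / t / c : ℝ) : EReal) - ramp ((Y ω / t : ℝ) : EReal)) := by
      rw [div_div]; ring
    rw [h3, norm_mul]
    by_cases hω : t * (1 / 2) < Y ω
    · rw [indicator_of_mem (show ω ∈ {ω | t * (1 / 2) < Y ω} from hω)]
      rw [if_pos (by rw [lt_div_iff₀ ht]; linarith)] at h2
      have := (norm_nonneg _).trans (hC ⊤)
      gcongr
      · exact hC _
      · exact h2
    · rw [indicator_of_notMem (show ω ∉ {ω | t * (1 / 2) < Y ω} from hω)]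
      rw [if_neg (by rw [lt_div_iff₀ ht]; linarith)] at h2
      have : c * ramp ((Y ω / t / c : ℝ) : EReal) - ramp ((Y ω / t : ℝ) : EReal) = 0 :=
        abs_nonpos_iff.1 h2
      rw [this, norm_zero, mul_zero]
  rw [integral_indicator_const _ hset, smul_eq_mul] at h1
  calc _ ≤ t * (P.real {ω | t * (1 / 2) < Y ω} * (C * (|c - 1| + 4 * |c⁻¹ - 1|))) := by gcongr
    _ = _ := by ring

/-- Vague convergence along tc identifies the limit under the normalization at tc with weight
ramp(Y/(tc)). Returning to the weight ramp(Y/t) costs o(1), so the weighted law at t has the same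
limit under both normalizations. -/
theorem IsCEVMLimit.slowlyVaryingNearOne (hX : Measurable X) (hY : Measurable Y)
    (hDA : StdDomainOfAttraction P Y) (hα : ∀ t : ℝ, 0 < t → 0 < α t) {μ : Measure Cone}
    (hμ : IsCEVMLimit P X Y α β μ) : SlowlyVaryingNearOne α β := by
  have := hμ.radon
  have hfin : IsFiniteMeasure (weightedMarginal μ ramp) :=
    isFiniteMeasure_weightedMarginal isWeight_ramp
  have hfinT : ∀ p : ℝ × ℝ, IsFiniteMeasure (weightedLaw P X Y ramp (α p.1) (β p.1) p.1) :=
    fun p => isFiniteMeasure_weightedLaw isWeight_ramp _ _ _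
  have ht : ∀ᶠ p : ℝ × ℝ in atTop ×ˢ 𝓝 1, 0 < p.1 := tendsto_fst.eventually_gt_atTop 0
  have hc : ∀ᶠ p : ℝ × ℝ in atTop ×ˢ 𝓝 1, p.2 ∈ Icc (1 / 2 : ℝ) 2 :=
    tendsto_snd.eventually (Icc_mem_nhds (by norm_num) (by norm_num))
  refine tendsto_one_zero_of_same_limit (T := fun p : ℝ × ℝ =>
    weightedLaw P X Y ramp (α p.1) (β p.1) p.1)
    (nonDegenerate_weightedMarginal hμ.nonDegenerate isWeight_ramp two_pos)
    (weightedMarginal_top hμ.nonDegenerate isWeight_ramp) ?_ (fun g hg => ?_) fun g hg => ?_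
  · filter_upwards [ht, hc] with p hp hpc
    exact div_pos (hα _ (mul_pos hp (by linarith [hpc.1]))) (hα _ hp)
  · refine ((tendsto_integral_weight hX hY hμ.tendsto isWeight_ramp hg).comp
      tendsto_fst).congr' ?_
    filter_upwards [ht] with p hp
    exact (integral_weightedLaw hX hY isWeight_ramp _ _ hp.le hg).symm
  · obtain ⟨C, hC⟩ := isCompact_univ.exists_bound_of_continuousOn (f := g) hg.continuousOn
    have h1 := (tendsto_integral_weight hX hY hμ.tendsto isWeight_ramp hg).comp
      (tendsto_fst_mul_snd one_pos)
    have h2 : Tendsto (fun p : ℝ × ℝ => C * (|p.2 - 1| + 4 * |p.2⁻¹ - 1|) *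
        (p.1 * P.real {ω | p.1 * (1 / 2) < Y ω})) (atTop ×ˢ 𝓝 1) (𝓝 0) := by
      have h3 : Tendsto (fun c : ℝ => C * (|c - 1| + 4 * |c⁻¹ - 1|)) (𝓝 1) (𝓝 0) := by
        have : ContinuousAt (fun c : ℝ => C * (|c - 1| + 4 * |c⁻¹ - 1|)) 1 := by
          fun_prop (disch := norm_num)
        simpa [ContinuousAt] using this
      simpa using (h3.comp tendsto_snd).mul ((hDA (1 / 2) (by norm_num)).comp tendsto_fst)
    have h4 : Tendsto (fun p : ℝ × ℝ =>
        p.1 * p.2 * ∫ ω, g (standardize (α (p.1 * p.2)) (β (p.1 * p.2)) (X ω)) *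
          ramp ((Y ω / (p.1 * p.2) : ℝ) : EReal) ∂P -
        p.1 * ∫ ω, g (standardize (α (p.1 * p.2)) (β (p.1 * p.2)) (X ω)) *
          ramp ((Y ω / p.1 : ℝ) : EReal) ∂P) (atTop ×ˢ 𝓝 1) (𝓝 0) := by
      refine squeeze_zero_norm' ?_ h2
      filter_upwards [ht, hc] with p hp hpc
      exact abs_integral_ramp_sub_le hX hY hg (fun x => hC x (mem_univ x)) _ _ hp hpc
    have h5 := h1.sub h4
    rw [sub_zero] at h5
    refine h5.congr' ?_
    filter_upwards [ht, hc] with p hp hpc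
    have h6 : 0 < p.1 * p.2 := mul_pos hp (by linarith [hpc.1])
    have h7 := integral_weightedLaw (P := P) hX hY isWeight_ramp (α p.1) (β p.1) hp.le
      (hg.comp (continuous_standardize (div_pos (hα _ h6) (hα _ hp))
        ((β (p.1 * p.2) - β p.1) / α p.1)))
    simp only [Function.comp_apply] at h7 ⊢
    rw [h7, sub_sub_cancel]
    simp_rw [standardize_standardize_ratio (hα _ hp) (hα _ h6)]

/-- The ratios in the definition of extended regular variation converge if the scales are
comparable. -/
theorem IsCEVMLimit.exists_tendsto (hX : Measurable X) (hY : Measurable Y)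
    (hα : ∀ t : ℝ, 0 < t → 0 < α t) {μ : Measure Cone}
    (hμ : IsCEVMLimit P X Y α β μ) {c : ℝ} (hc : 0 < c) {m M : ℝ} (hm : 0 < m)
    (hmM : ∀ᶠ t in atTop, α (t * c) / α t ∈ Icc m M) :
    ∃ a b : ℝ, 0 < a ∧ Tendsto (fun t => α (t * c) / α t) atTop (𝓝 a) ∧
      Tendsto (fun t => (β (t * c) - β t) / α t) atTop (𝓝 b) := by
  have := hμ.radon
  have hw := isWeight_ramp_mul hc
  have hfin : IsFiniteMeasure (weightedMarginal μ ramp) :=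
    isFiniteMeasure_weightedMarginal isWeight_ramp
  have hfin' : IsFiniteMeasure
      (weightedMarginal μ fun e => ramp (standardize c⁻¹ 0 e)) :=
    isFiniteMeasure_weightedMarginal hw
  have hfinT : ∀ t : ℝ, IsFiniteMeasure (weightedLaw P X Y ramp (α t) (β t) t) :=
    fun p => isFiniteMeasure_weightedLaw isWeight_ramp _ _ _
  have hc' : ENNReal.ofReal c⁻¹ ≠ 0 := by simpa using hc
  have hfin'' := Measure.smul_finite (weightedMarginal μ fun e => ramp (standardize c⁻¹ 0 e))
    (ENNReal.ofReal_ne_top (r := c⁻¹))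
  refine exists_tendsto_of_scale_bounded (T := fun t : ℝ => weightedLaw P X Y ramp (α t) (β t) t)
    (H' := ENNReal.ofReal c⁻¹ • weightedMarginal μ fun e => ramp (standardize c⁻¹ 0 e))
    (nonDegenerate_weightedMarginal hμ.nonDegenerate isWeight_ramp two_pos) (fun d => ?_)
    (weightedMarginal_top hμ.nonDegenerate isWeight_ramp) ?_ hm hmM (fun g hg => ?_)
    fun g hg => ?_
  · rw [Measure.smul_apply, smul_eq_mul]
    exact mul_ne_zero hc'
      (nonDegenerate_weightedMarginal hμ.nonDegenerate hw (by positivity) d)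
  · rw [Measure.smul_apply, weightedMarginal_top hμ.nonDegenerate hw, smul_zero]
  · refine (tendsto_integral_weight hX hY hμ.tendsto isWeight_ramp hg).congr' ?_
    filter_upwards [eventually_gt_atTop 0] with t ht
    exact (integral_weightedLaw hX hY isWeight_ramp _ _ ht.le hg).symm
  · rw [integral_smul_measure, ENNReal.toReal_ofReal (inv_pos.2 hc).le, smul_eq_mul]
    -- Vague convergence is used at time tc. Writing t = c⁻¹ · tc and Y/t = c · Y/(tc) produces the
    -- factor c⁻¹ and the weight ramp(c ·) of the second limit.
    refine (((tendsto_integral_weight hX hY hμ.tendsto hw hg).comp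
      (tendsto_id.atTop_mul_const hc)).const_mul c⁻¹).congr' ?_
    filter_upwards [eventually_gt_atTop 0] with t ht
    have h6 : 0 < t * c := mul_pos ht hc
    have h7 := integral_weightedLaw (P := P) hX hY isWeight_ramp (α t) (β t) ht.le
      (hg.comp (continuous_standardize (div_pos (hα _ h6) (hα _ ht))
        ((β (t * c) - β t) / α t)))
    simp only [Function.comp_apply, id] at h7 ⊢
    rw [h7]
    simp_rw [standardize_standardize_ratio (hα _ ht) (hα _ h6), standardize_coe]
    rw [← mul_assoc, ← mul_assoc, mul_comm c⁻¹, mul_assoc t, inv_mul_cancel₀ hc.ne', mul_one]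
    have h8 : ∀ ω, (Y ω / (t * c) - 0) / c⁻¹ = Y ω / t := fun ω => by
      rw [sub_zero, div_inv_eq_mul]; field_simp
    simp_rw [h8]

end limit

/-! ### Functional equations for the limits -/

/-- For large n the root x = c^(1/n) is so close to 1 that one step changes α by a factor in [1/2,
2] eventually; n steps give the bounds 2^(-n) and 2^n. -/
theorem exists_scale_bounds {α β : ℝ → ℝ} (hα : ∀ t : ℝ, 0 < t → 0 < α t)
    (h1 : SlowlyVaryingNearOne α β) {c : ℝ} (hc : 0 < c) :
    ∃ m M : ℝ, 0 < m ∧ ∀ᶠ t in atTop, α (t * c) / α t ∈ Icc m M := by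
  have h2 : ∀ᶠ x in 𝓝 (1 : ℝ), ∀ᶠ t in atTop, α (t * x) / α t ∈ Icc (1 / 2 : ℝ) 2 := by
    have h3 : Tendsto (fun p : ℝ × ℝ => α (p.1 * p.2) / α p.1) (atTop ×ˢ 𝓝 1) (𝓝 1) :=
      (continuous_fst.tendsto _).comp h1
    have h4 := h3.eventually (Icc_mem_nhds (by norm_num : (1 / 2 : ℝ) < 1) one_lt_two)
    exact (eventually_swap_iff.1 h4).curry
  have h3 : Tendsto (fun n : ℕ => c ^ ((n : ℝ)⁻¹)) atTop (𝓝 1) := by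
    have := (Real.continuousAt_const_rpow hc.ne' (b := 0)).tendsto.comp
      (tendsto_inv_atTop_nhds_zero_nat (𝕜 := ℝ))
    simpa [Function.comp_def] using this
  obtain ⟨n, hn, hn0⟩ := ((h3.eventually h2).and (eventually_ne_atTop 0)).exists
  set x := c ^ ((n : ℝ)⁻¹) with hx
  have hx0 : 0 < x := Real.rpow_pos_of_pos hc _
  have hxn : x ^ n = c := Real.rpow_inv_natCast_pow hc.le hn0
  have key : ∀ k : ℕ, ∀ᶠ t in atTop, α (t * x ^ k) / α t ∈ Icc ((1 / 2 : ℝ) ^ k) (2 ^ k) := by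
    intro k
    induction k with
    | zero =>
      filter_upwards [eventually_gt_atTop 0] with t ht
      simp [(hα t ht).ne']
    | succ k ih =>
      filter_upwards [ih, (tendsto_id.atTop_mul_const (pow_pos hx0 k)).eventually hn,
        eventually_gt_atTop 0] with t h4 h5 ht
      simp only [id] at h5
      have h6 := hα _ (mul_pos ht (pow_pos hx0 k))
      have h7 : α (t * x ^ (k + 1)) / α t =
          (α (t * x ^ k) / α t) * (α (t * x ^ k * x) / α (t * x ^ k)) := by
        rw [pow_succ, ← mul_assoc]; field_simp
      rw [h7, pow_succ, pow_succ]
      have h8 := hα _ ht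
      exact ⟨mul_le_mul h4.1 h5.1 (by norm_num) (by positivity),
        mul_le_mul h4.2 h5.2 (by linarith [h5.1]) (by positivity)⟩
  have := key n
  rw [hxn] at this
  exact ⟨_, _, by positivity, this⟩

theorem tendsto_limit_near_one {F : ℝ → ℝ → ℝ} {a : ℝ → ℝ} {L : ℝ}
    (hF : Tendsto (fun p : ℝ × ℝ => F p.1 p.2) (atTop ×ˢ 𝓝 1) (𝓝 L))
    (ha : ∀ c, 0 < c → Tendsto (fun t => F t c) atTop (𝓝 (a c))) :
    Tendsto a (𝓝 1) (𝓝 L) := by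
  rw [Metric.tendsto_nhds]
  intro ε hε
  have h := (eventually_swap_iff.1 (Metric.tendsto_nhds.1 hF (ε / 2) (by positivity))).curry
  filter_upwards [h, lt_mem_nhds one_pos] with c hc hc0
  have := le_of_tendsto ((ha c hc0).dist tendsto_const_nhds) (hc.mono fun t ht => ht.le)
  linarith

/-- In logarithmic coordinates this is Cauchy's equation; an additive function continuous at 0 is
linear. -/
theorem exists_rpow_of_mul {a : ℝ → ℝ} (ha : ∀ c, 0 < c → 0 < a c)
    (hmul : ∀ c d, 0 < c → 0 < d → a (c * d) = a c * a d) (h1 : Tendsto a (𝓝 1) (𝓝 1)) :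
    ∃ ρ : ℝ, ∀ c, 0 < c → a c = c ^ ρ := by
  have ha1 : a 1 = 1 := tendsto_nhds_unique (tendsto_pure_nhds a 1)
    (h1.mono_left (pure_le_nhds 1))
  let f : ℝ →+ ℝ :=
    { toFun := fun s => Real.log (a (Real.exp s))
      map_zero' := by simp [ha1]
      map_add' := fun s t => by
        rw [Real.exp_add, hmul _ _ (Real.exp_pos s) (Real.exp_pos t),
          Real.log_mul (ha _ (Real.exp_pos s)).ne' (ha _ (Real.exp_pos t)).ne'] }
  have hf : Continuous f := by
    refine continuous_of_continuousAt_zero f ?_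
    have h2 : Tendsto Real.exp (𝓝 0) (𝓝 1) := by simpa using Real.continuous_exp.tendsto 0
    have h3 := (Real.continuousAt_log one_ne_zero).tendsto.comp (h1.comp h2)
    rw [ContinuousAt, map_zero]
    rw [Real.log_one] at h3
    exact h3
  refine ⟨f 1, fun c hc => ?_⟩
  have h2 := map_real_smul f hf (Real.log c) 1
  rw [smul_eq_mul, mul_one, smul_eq_mul] at h2
  have h3 : f (Real.log c) = Real.log (a c) := by
    change Real.log (a (Real.exp (Real.log c))) = _
    rw [Real.exp_log hc]
  rw [h3] at h2
  rw [Real.rpow_def_of_pos hc, ← h2, Real.exp_log (ha c hc)]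

theorem exists_log_of_add {b : ℝ → ℝ}
    (hadd : ∀ c d, 0 < c → 0 < d → b (c * d) = b c + b d) (h1 : Tendsto b (𝓝 1) (𝓝 0)) :
    ∃ k : ℝ, ∀ c, 0 < c → b c = k * Real.log c := by
  obtain ⟨k, hk⟩ := exists_rpow_of_mul (a := fun c => Real.exp (b c))
    (fun c _ => Real.exp_pos _) (fun c d hc hd => by rw [hadd c d hc hd, Real.exp_add])
    (by simpa [Function.comp_def] using (Real.continuous_exp.tendsto 0).comp h1)
  refine ⟨k, fun c hc => ?_⟩
  have := hk c hc
  rw [Real.rpow_def_of_pos hc] at this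
  rw [Real.exp_injective this, mul_comm]

/-- Extended regular variation follows from the existence of the limits and their continuity
at `1`. -/
theorem exists_erv_of_tendsto {α β : ℝ → ℝ} (hα : ∀ t : ℝ, 0 < t → 0 < α t)
    (h1 : SlowlyVaryingNearOne α β)
    (hlim : ∀ c : ℝ, 0 < c → ∃ a b : ℝ, 0 < a ∧ Tendsto (fun t => α (t * c) / α t) atTop (𝓝 a) ∧
      Tendsto (fun t => (β (t * c) - β t) / α t) atTop (𝓝 b)) :
    ∃ ρ k : ℝ, ERV ρ k α β := by
  choose! a b ha hA hB using hlim
  have hmul_top : ∀ {c : ℝ}, 0 < c → Tendsto (fun t : ℝ => t * c) atTop atTop := fun hc =>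
    tendsto_id.atTop_mul_const hc
  have hmul : ∀ c d, 0 < c → 0 < d → a (c * d) = a c * a d := by
    intro c d hc hd
    refine tendsto_nhds_unique (hA _ (mul_pos hc hd))
      (((hA c hc).mul ((hA d hd).comp (hmul_top hc))).congr' ?_)
    filter_upwards [eventually_gt_atTop 0] with t ht
    have := hα _ (mul_pos ht hc)
    simp only [Function.comp_apply]
    rw [← mul_assoc]
    field_simp
  have hadd : ∀ c d, 0 < c → 0 < d → b (c * d) = b c + a c * b d := by
    intro c d hc hd
    refine tendsto_nhds_unique (hB _ (mul_pos hc hd))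
      (((hB c hc).add ((hA c hc).mul ((hB d hd).comp (hmul_top hc)))).congr' ?_)
    filter_upwards [eventually_gt_atTop 0] with t ht
    have := hα _ (mul_pos ht hc)
    have := hα _ ht
    simp only [Function.comp_apply]
    rw [← mul_assoc]
    field_simp
    ring
  have ha1 : Tendsto a (𝓝 1) (𝓝 1) :=
    tendsto_limit_near_one ((continuous_fst.tendsto _).comp h1) hA
  have hb1 : Tendsto b (𝓝 1) (𝓝 0) :=
    tendsto_limit_near_one ((continuous_snd.tendsto _).comp h1) hB
  obtain ⟨ρ, hρ⟩ := exists_rpow_of_mul ha hmul ha1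
  have hAρ : ∀ x : ℝ, 0 < x → Tendsto (fun t => α (t * x) / α t) atTop (𝓝 (x ^ ρ)) :=
    fun x hx => hρ x hx ▸ hA x hx
  suffices ∃ k, ∀ c, 0 < c → b c = psi ρ k c by
    obtain ⟨k, hk⟩ := this
    exact ⟨ρ, k, hAρ, fun x hx => hk x hx ▸ hB x hx⟩
  by_cases h0 : ρ = 0
  · obtain ⟨k, hk⟩ := exists_log_of_add (b := b)
      (fun c d hc hd => by rw [hadd c d hc hd, hρ c hc, h0, Real.rpow_zero, one_mul]) hb1
    exact ⟨k, fun c hc => by rw [hk c hc, psi, if_pos h0]⟩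
  · have h2 : (2 : ℝ) ^ ρ - 1 ≠ 0 := by
      rw [sub_ne_zero]
      intro h
      have h' := congrArg Real.log h
      rw [Real.log_rpow two_pos, Real.log_one] at h'
      exact h0 ((mul_eq_zero.1 h').resolve_right (Real.log_pos one_lt_two).ne')
    -- Expanding b(2c) = b(c·2) both ways gives b(c)(2^ρ - 1) = b(2)(c^ρ - 1), which fixes the
    -- constant.
    refine ⟨ρ * b 2 / (2 ^ ρ - 1), fun c hc => ?_⟩
    have h3 := hadd c 2 hc two_pos
    have h4 := hadd 2 c two_pos hc
    rw [mul_comm 2 c, h3, hρ c hc, hρ 2 two_pos] at h4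
    rw [psi, if_neg h0]
    field_simp
    linear_combination -h4

theorem IsCEVMLimit.exists_erv {Ω : Type*} [MeasurableSpace Ω] {P : Measure Ω}
    [IsProbabilityMeasure P] {X Y : Ω → ℝ} {α β : ℝ → ℝ} (hX : Measurable X) (hY : Measurable Y)
    (hDA : StdDomainOfAttraction P Y) (hα : ∀ t : ℝ, 0 < t → 0 < α t) {μ : Measure Cone}
    (hμ : IsCEVMLimit P X Y α β μ) : ∃ ρ k : ℝ, ERV ρ k α β := by
  have h1 := hμ.slowlyVaryingNearOne hX hY hDA hα
  refine exists_erv_of_tendsto hα h1 fun c hc => ?_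
  obtain ⟨m, M, hm, hmM⟩ := exists_scale_bounds hα h1 hc
  exact hμ.exists_tendsto hX hY hα hc hm hmM

/-! ### Normalized transition functions and their mixtures -/

section kernel

variable {K : Kernel ℝ EReal} [IsMarkovKernel K] {α β : ℝ → ℝ} {G : ProbabilityMeasure EReal}

theorem integral_scaledKernel (t : ℝ) {g : EReal → ℝ} (hg : Continuous g) :
    ∫ z, g z ∂(scaledKernel K α β t : Measure EReal) =
      ∫ e, g (standardize (α t) (β t) e) ∂(K t) :=
  integral_map (measurable_standardize _ _).aemeasurable hg.aestronglyMeasurable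

theorem tendsto_integral_scaledKernel (hconv : Tendsto (scaledKernel K α β) atTop (𝓝 G))
    {g : EReal → ℝ} (hg : Continuous g) :
    Tendsto (fun t => ∫ z, g z ∂(scaledKernel K α β t : Measure EReal)) atTop
      (𝓝 (∫ z, g z ∂(G : Measure EReal))) :=
  ProbabilityMeasure.tendsto_iff_forall_integral_tendsto.1 hconv
    (BoundedContinuousFunction.mkOfCompact ⟨g, hg⟩)

/-- The kernel at `s`, normalized at `t`, converges if the two normalizations are
asymptotically related by an affine transformation. -/
theorem tendsto_integral_kernel (hα : ∀ t : ℝ, 0 < t → 0 < α t)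
    (hconv : Tendsto (scaledKernel K α β) atTop (𝓝 G)) {ι : Type*} {l : Filter ι}
    {t s : ι → ℝ} {v : ι → EReal} {a b : ℝ} {v₀ : EReal} (ha : 0 < a)
    (ht : ∀ᶠ i in l, 0 < t i) (hs : Tendsto s l atTop)
    (hA : Tendsto (fun i => α (s i) / α (t i)) l (𝓝 a))
    (hB : Tendsto (fun i => (β (s i) - β (t i)) / α (t i)) l (𝓝 b))
    (hv : Tendsto v l (𝓝 v₀)) {f : EReal × EReal → ℝ} (hf : Continuous f) :
    Tendsto (fun i => ∫ e, f (standardize (α (t i)) (β (t i)) e, v i) ∂(K (s i))) l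
      (𝓝 (∫ z, f (standardize a⁻¹ (-(b / a)) z, v₀) ∂(G : Measure EReal))) := by
  have hA' : Tendsto (fun i => α (t i) / α (s i)) l (𝓝 a⁻¹) :=
    (hA.inv₀ ha.ne').congr fun i => inv_div _ _
  have hB' : Tendsto (fun i => (β (t i) - β (s i)) / α (s i)) l (𝓝 (-(b / a))) := by
    refine (hB.div hA ha.ne').neg.congr' ?_
    filter_upwards [ht, hs.eventually_gt_atTop 0] with i h1 h2
    have := hα _ h1
    have := hα _ h2
    simp only [Pi.div_apply]
    field_simp
    ring
  have h := tendsto_integral_of_tendsto_prod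
    (T := fun i => (scaledKernel K α β (s i) : Measure EReal))
    (fun g hg => (tendsto_integral_scaledKernel hconv hg).comp hs)
    (h := fun i z => f (standardize (α (t i) / α (s i)) ((β (t i) - β (s i)) / α (s i)) z, v i))
    (k := fun z => f (standardize a⁻¹ (-(b / a)) z, v₀)) (by
      filter_upwards [ht, hs.eventually_gt_atTop 0] with i h1 h2
      exact hf.comp ((continuous_standardize (div_pos (hα _ h1) (hα _ h2)) _).prodMk
        continuous_const))
    (hf.comp ((continuous_standardize (inv_pos.2 ha) _).prodMk continuous_const)) (fun x =>
      (hf.tendsto _).comp ((tendsto_standardize (inv_pos.2 ha) (hA'.comp tendsto_fst)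
        (hB'.comp tendsto_fst) tendsto_snd).prodMk_nhds (hv.comp tendsto_fst)))
  refine h.congr' ?_
  filter_upwards [ht, hs.eventually_gt_atTop 0] with i h1 h2
  refine (integral_scaledKernel _ (hf.comp ((continuous_standardize
    (div_pos (hα _ h1) (hα _ h2)) _).prodMk continuous_const))).trans ?_
  simp_rw [Function.comp_def, standardize_standardize_ratio (hα _ h2) (hα _ h1)]

/-- The affine transformation `z ↦ u ^ ρ * z + ψ u` of the extended real line. -/
def affineMap (ρ k u : ℝ) (z : EReal) : EReal :=
  standardize (u ^ ρ)⁻¹ (-(psi ρ k u / u ^ ρ)) z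

theorem continuousAt_psi (ρ k : ℝ) {u : ℝ} (hu : 0 < u) : ContinuousAt (psi ρ k) u := by
  have : psi ρ k = if ρ = 0 then fun x => k * Real.log x else fun x => k * (x ^ ρ - 1) / ρ := by
    ext x; simp only [psi]; split_ifs <;> rfl
  rw [this]
  split_ifs
  · exact continuousAt_const.mul (Real.continuousAt_log hu.ne')
  · exact (continuousAt_const.mul
      ((Real.continuousAt_rpow_const _ _ (Or.inl hu.ne')).sub continuousAt_const)).div_const _

theorem measurable_psi (ρ k : ℝ) : Measurable (psi ρ k) := by
  unfold psi
  split_ifs <;> fun_prop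

theorem measurable_affineMap (ρ k : ℝ) :
    Measurable fun p : ℝ × EReal => affineMap ρ k p.1 p.2 := by
  have := measurable_psi ρ k
  unfold affineMap standardize
  simp only [sub_eq_add_neg, div_eq_mul_inv, ← EReal.coe_inv]
  fun_prop

theorem tendsto_affineMap (ρ k : ℝ) {ι : Type*} {l : Filter ι} {u : ι → ℝ} {z : ι → EReal}
    {u₀ : ℝ} {z₀ : EReal} (hu₀ : 0 < u₀) (hu : Tendsto u l (𝓝 u₀)) (hz : Tendsto z l (𝓝 z₀)) :
    Tendsto (fun i => affineMap ρ k (u i) (z i)) l (𝓝 (affineMap ρ k u₀ z₀)) := by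
  have h1 := Real.rpow_pos_of_pos hu₀ ρ
  have h2 : Tendsto (fun i => u i ^ ρ) l (𝓝 (u₀ ^ ρ)) :=
    (Real.continuousAt_rpow_const _ _ (Or.inl hu₀.ne')).tendsto.comp hu
  exact tendsto_standardize (inv_pos.2 h1) (h2.inv₀ h1.ne')
    ((((continuousAt_psi ρ k hu₀).tendsto.comp hu).div h2 h1.ne').neg) hz

theorem continuous_affineMap (ρ k : ℝ) {u : ℝ} (hu : 0 < u) : Continuous (affineMap ρ k u) :=
  continuous_iff_continuousAt.2 fun _ => tendsto_affineMap ρ k hu tendsto_const_nhds tendsto_id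

theorem affineMap_coe (ρ k : ℝ) {u : ℝ} (hu : 0 < u) (z : ℝ) :
    affineMap ρ k u z = ((u ^ ρ * z + psi ρ k u : ℝ) : EReal) := by
  have := Real.rpow_pos_of_pos hu ρ
  rw [affineMap, standardize_coe]
  congr 1
  field_simp
  ring

theorem affineMap_top (ρ k : ℝ) {u : ℝ} (hu : 0 < u) : affineMap ρ k u ⊤ = ⊤ :=
  standardize_top (inv_pos.2 (Real.rpow_pos_of_pos hu ρ)) _

theorem affineMap_bot (ρ k : ℝ) {u : ℝ} (hu : 0 < u) : affineMap ρ k u ⊥ = ⊥ :=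
  standardize_bot (inv_pos.2 (Real.rpow_pos_of_pos hu ρ)) _

theorem affineMap_preimage_top (ρ k : ℝ) {u : ℝ} (hu : 0 < u) :
    affineMap ρ k u ⁻¹' {⊤} = {⊤} := by
  ext z
  induction z with
  | bot => simp [affineMap_bot ρ k hu]
  | top => simp [affineMap_top ρ k hu]
  | coe x => simp only [mem_preimage, affineMap_coe ρ k hu, mem_singleton_iff, EReal.coe_ne_top]

theorem affineMap_preimage_range_diff (ρ k : ℝ) {u : ℝ} (hu : 0 < u) (c : ℝ) :
    affineMap ρ k u ⁻¹' (range ((↑) : ℝ → EReal) \ {(c : EReal)}) =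
      range ((↑) : ℝ → EReal) \ {(((c - psi ρ k u) / u ^ ρ : ℝ) : EReal)} := by
  have h := Real.rpow_pos_of_pos hu ρ
  ext z
  induction z with
  | bot => simp [affineMap_bot ρ k hu]
  | top => simp [affineMap_top ρ k hu]
  | coe x =>
    simp only [mem_preimage, affineMap_coe ρ k hu, Set.mem_sdiff, mem_range_self, true_and,
      mem_singleton_iff, EReal.coe_eq_coe_iff]
    rw [eq_div_iff h.ne', mul_comm x, eq_sub_iff_add_eq]

theorem affineMap_preimage_Iic (ρ k : ℝ) {u : ℝ} (hu : 0 < u) (x : ℝ) :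
    affineMap ρ k u ⁻¹' Iic (x : EReal) =
      Iic ((u ^ (-ρ) * (x - psi ρ k u) : ℝ) : EReal) := by
  have h := Real.rpow_pos_of_pos hu ρ
  ext z
  induction z with
  | bot => simp [affineMap_bot ρ k hu]
  | top => simp only [mem_preimage, affineMap_top ρ k hu, mem_Iic, top_le_iff, EReal.coe_ne_top]
  | coe y =>
    simp only [mem_preimage, affineMap_coe ρ k hu, mem_Iic, EReal.coe_le_coe_iff]
    rw [Real.rpow_neg hu.le, ← le_sub_iff_add_le, ← div_eq_inv_mul, le_div_iff₀ h, mul_comm y]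

theorem measurable_integral_kernel {K : Kernel ℝ EReal} {g : EReal → ℝ} (hg : Continuous g) (a b s : ℝ) :
    StronglyMeasurable fun u : ℝ => ∫ e, g (standardize a b e) ∂(K (s * u)) :=
  ((hg.measurable.comp (measurable_standardize a b)).stronglyMeasurable.integral_kernel
    (κ := K)).comp_measurable (measurable_const_mul s)

/-- The mixture of the transition functions `K (s u)` over `u ∈ (1, 2]`, affinely normalized. -/
def kernelMixture (K : Kernel ℝ EReal) [IsMarkovKernel K] (a b s : ℝ) : Measure EReal :=
  ((volume.restrict (Ioc (1 : ℝ) 2)) ⊗ₘ (K.comap (s * ·) (measurable_const_mul s))).map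
    fun p => standardize a b p.2

instance (a b s : ℝ) : IsFiniteMeasure (kernelMixture K a b s) := by
  unfold kernelMixture
  infer_instance

theorem integral_kernelMixture (a b s : ℝ) {g : EReal → ℝ} (hg : Continuous g) :
    ∫ x, g x ∂(kernelMixture K a b s) =
      ∫ u in (1 : ℝ)..2, ∫ e, g (standardize a b e) ∂(K (s * u)) := by
  obtain ⟨C, hC⟩ := isCompact_univ.exists_bound_of_continuousOn (f := g) hg.continuousOn
  have hm : Measurable fun p : ℝ × EReal => standardize a b p.2 :=
    (measurable_standardize a b).comp measurable_snd
  rw [kernelMixture, integral_map hm.aemeasurable hg.aestronglyMeasurable,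
    Measure.integral_compProd, intervalIntegral.integral_of_le one_le_two]
  · rfl
  · exact Integrable.of_bound (hg.measurable.comp hm).aestronglyMeasurable C
      (ae_of_all _ fun p => hC _ (mem_univ _))

/-- The mixture of the images of `G` under the limiting affine transformations with `u ∈ (1, 2]`. -/
def limitMixture (G : ProbabilityMeasure EReal) (ρ k : ℝ) : Measure EReal :=
  ((volume.restrict (Ioc (1 : ℝ) 2)).prod (G : Measure EReal)).map fun p => affineMap ρ k p.1 p.2

instance (ρ k : ℝ) : IsFiniteMeasure (limitMixture G ρ k) := by
  unfold limitMixture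
  infer_instance

theorem integral_limitMixture (ρ k : ℝ) {g : EReal → ℝ} (hg : Continuous g) :
    ∫ x, g x ∂(limitMixture G ρ k) =
      ∫ u in Ioc (1 : ℝ) 2, ∫ z, g (affineMap ρ k u z) ∂(G : Measure EReal) := by
  obtain ⟨C, hC⟩ := isCompact_univ.exists_bound_of_continuousOn (f := g) hg.continuousOn
  rw [limitMixture, integral_map (measurable_affineMap ρ k).aemeasurable hg.aestronglyMeasurable,
    integral_prod]
  exact Integrable.of_bound (hg.measurable.comp (measurable_affineMap ρ k)).aestronglyMeasurable C
      (ae_of_all _ fun p => hC _ (mem_univ _))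

theorem limitMixture_apply (ρ k : ℝ) {A : Set EReal} (hA : MeasurableSet A) :
    limitMixture G ρ k A =
      ∫⁻ u in Ioc (1 : ℝ) 2, (G : Measure EReal) (affineMap ρ k u ⁻¹' A) := by
  rw [limitMixture, Measure.map_apply (measurable_affineMap ρ k) hA,
    Measure.prod_apply (measurable_affineMap ρ k hA)]
  rfl

theorem limitMixture_top (hGtop : (G : Measure EReal) {⊤} = 0) (ρ k : ℝ) :
    limitMixture G ρ k {⊤} = 0 := by
  rw [limitMixture_apply ρ k (measurableSet_singleton _)]
  refine (setLIntegral_congr_fun measurableSet_Ioc fun u hu => ?_).trans lintegral_zero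
  rw [affineMap_preimage_top ρ k (by linarith [hu.1]), hGtop]

/-- For each u the preimage of ℝ without a point is again ℝ without a point, so the integrand is
positive on all of (1,2]. -/
theorem nonDegenerate_limitMixture (hG : NonDegenerate (G : Measure EReal)) (ρ k : ℝ) :
    NonDegenerate (limitMixture G ρ k) := by
  intro c h
  rw [limitMixture_apply ρ k (measurableSet_range_diff c), lintegral_eq_zero_iff] at h
  · have h1 := (ae_restrict_iff' measurableSet_Ioc).1 h
    have h2 : ∀ᵐ u : ℝ, u ∉ Ioc (1 : ℝ) 2 := by
      filter_upwards [h1] with u hu huI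
      have := hu huI
      rw [affineMap_preimage_range_diff ρ k (by linarith [huI.1])] at this
      exact hG _ this
    have h3 : volume (Ioc (1 : ℝ) 2) = 0 :=
      measure_mono_null (fun u hu => not_not.2 hu) (ae_iff.1 h2)
    rw [Real.volume_Ioc] at h3
    norm_num at h3
  · exact measurable_measure_prodMk_left
      (measurable_affineMap ρ k (measurableSet_range_diff c))

theorem tendsto_ite_Ioc_near_one {u : ℝ} (h1 : u ≠ 1) (h2 : u ≠ 2) :
    ∀ᶠ c : ℝ in 𝓝 1, (u ∈ Ioc (1 / c) (2 / c) ↔ u ∈ Ioc (1 : ℝ) 2) := by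
  have h3 : Tendsto (fun c : ℝ => 1 / c) (𝓝 1) (𝓝 1) := by
    simpa using (tendsto_inv₀ (one_ne_zero (α := ℝ)))
  have h4 : Tendsto (fun c : ℝ => 2 / c) (𝓝 1) (𝓝 2) := by
    simpa [div_eq_mul_inv] using h3.const_mul 2
  have h5 : ∀ᶠ c : ℝ in 𝓝 1, (1 / c < u ↔ 1 < u) := by
    rcases lt_or_gt_of_ne h1 with h | h
    · filter_upwards [h3.eventually_const_lt h] with c hc
      exact ⟨fun h' => absurd h' hc.not_gt, fun h' => absurd h' h.not_gt⟩
    · filter_upwards [h3.eventually_lt_const h] with c hc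
      exact ⟨fun _ => h, fun _ => hc⟩
  have h6 : ∀ᶠ c : ℝ in 𝓝 1, (u ≤ 2 / c ↔ u ≤ 2) := by
    rcases lt_or_gt_of_ne h2 with h | h
    · filter_upwards [h4.eventually_const_lt h] with c hc
      exact ⟨fun _ => h.le, fun _ => hc.le⟩
    · filter_upwards [h4.eventually_lt_const h] with c hc
      exact ⟨fun h' => absurd h' hc.not_ge, fun h' => absurd h' h.not_ge⟩
  filter_upwards [h5, h6] with c h7 h8
  rw [mem_Ioc, mem_Ioc, h7, h8]

theorem tendsto_integral_kernel_mul (hα : ∀ t : ℝ, 0 < t → 0 < α t)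
    (hconv : Tendsto (scaledKernel K α β) atTop (𝓝 G)) {ρ k : ℝ} (hERV : ERV ρ k α β)
    {g : EReal → ℝ} (hg : Continuous g) {u : ℝ} (hu : 0 < u) :
    Tendsto (fun t => ∫ e, g (standardize (α t) (β t) e) ∂(K (t * u))) atTop
      (𝓝 (∫ z, g (affineMap ρ k u z) ∂(G : Measure EReal))) :=
  tendsto_integral_kernel hα hconv (Real.rpow_pos_of_pos hu ρ) (eventually_gt_atTop 0)
    (tendsto_id.atTop_mul_const hu) (hERV.1 u hu) (hERV.2 u hu)
    (tendsto_const_nhds (x := (0 : EReal))) (hg.comp continuous_fst)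

/-- Dominated convergence needs the limits only for fixed u, and measurability in u only of the
kernel, since α and β are evaluated at t. The moving interval anticipates the substitution u ↦ cu;
its indicator stabilizes off the endpoints 1 and 2. -/
theorem tendsto_kernelMixture (hα : ∀ t : ℝ, 0 < t → 0 < α t)
    (hconv : Tendsto (scaledKernel K α β) atTop (𝓝 G)) {ρ k : ℝ} (hERV : ERV ρ k α β)
    {g : EReal → ℝ} (hg : Continuous g) :
    Tendsto (fun p : ℝ × ℝ => ∫ u in Ioc (1 / p.2) (2 / p.2),
      ∫ e, g (standardize (α p.1) (β p.1) e) ∂(K (p.1 * u))) (atTop ×ˢ 𝓝 1)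
      (𝓝 (∫ x, g x ∂(limitMixture G ρ k))) := by
  obtain ⟨C, hC⟩ := isCompact_univ.exists_bound_of_continuousOn (f := g) hg.continuousOn
  have hC0 : 0 ≤ C := (norm_nonneg _).trans (hC ⊤ (mem_univ _))
  rw [integral_limitMixture ρ k hg, ← integral_indicator measurableSet_Ioc]
  simp_rw [← integral_indicator measurableSet_Ioc]
  refine tendsto_integral_filter_of_dominated_convergence
    ((Ioc (0 : ℝ) 4).indicator fun _ => C) ?_ ?_ ?_ ?_
  · exact Eventually.of_forall fun p =>
      ((measurable_integral_kernel hg _ _ _).indicator measurableSet_Ioc).aestronglyMeasurable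
  · have hc : ∀ᶠ p : ℝ × ℝ in atTop ×ˢ 𝓝 1, 1 / 2 < p.2 :=
      tendsto_snd.eventually (lt_mem_nhds (by norm_num))
    filter_upwards [hc] with p hp
    refine ae_of_all _ fun u => ?_
    by_cases hu : u ∈ Ioc (1 / p.2) (2 / p.2)
    · have hp0 : 0 < p.2 := by linarith
      have hu' : u ∈ Ioc (0 : ℝ) 4 := by
        refine ⟨(by positivity : 0 < 1 / p.2).trans hu.1, hu.2.trans ?_⟩
        rw [div_le_iff₀ hp0]; linarith
      rw [indicator_of_mem hu, indicator_of_mem hu']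
      refine (norm_integral_le_of_norm_le_const (ae_of_all _ fun e => hC _ (mem_univ _))).trans ?_
      simp
    · rw [indicator_of_notMem hu, norm_zero]
      exact indicator_nonneg (fun _ _ => hC0) u
  · exact (integrable_indicator_iff measurableSet_Ioc).2 (by simp)
  · have h12 : ∀ᵐ u : ℝ, u ≠ 1 ∧ u ≠ 2 := by
      filter_upwards [compl_mem_ae_iff.2 (measure_singleton (1 : ℝ)),
        compl_mem_ae_iff.2 (measure_singleton (2 : ℝ))] with u h1 h2
      exact ⟨h1, h2⟩
    filter_upwards [h12] with u hu
    have hev := (tendsto_snd (f := (atTop : Filter ℝ)) (g := 𝓝 (1 : ℝ))).eventually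
      (tendsto_ite_Ioc_near_one hu.1 hu.2)
    by_cases huI : u ∈ Ioc (1 : ℝ) 2
    · rw [indicator_of_mem huI]
      refine ((tendsto_integral_kernel_mul hα hconv hERV hg (by linarith [huI.1])).comp
        tendsto_fst).congr' ?_
      filter_upwards [hev] with p hp
      rw [indicator_of_mem (hp.2 huI)]
      rfl
    · rw [indicator_of_notMem huI]
      refine tendsto_const_nhds.congr' ?_
      filter_upwards [hev] with p hp
      rw [indicator_of_notMem (fun h => huI (hp.1 h))]

/-- Extended regular variation is locally uniform near one: no measurability of `α` and `β` is
needed since they normalize a measurable transition function. -/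
theorem ERV.slowlyVaryingNearOne (hα : ∀ t : ℝ, 0 < t → 0 < α t)
    (hGtop : (G : Measure EReal) {⊤} = 0) (hG : NonDegenerate (G : Measure EReal))
    (hconv : Tendsto (scaledKernel K α β) atTop (𝓝 G)) {ρ k : ℝ} (hERV : ERV ρ k α β) :
    SlowlyVaryingNearOne α β := by
  have ht : ∀ᶠ p : ℝ × ℝ in atTop ×ˢ 𝓝 1, 0 < p.1 := tendsto_fst.eventually_gt_atTop 0
  have hc : ∀ᶠ p : ℝ × ℝ in atTop ×ˢ 𝓝 1, 0 < p.2 :=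
    tendsto_snd.eventually (lt_mem_nhds one_pos)
  refine tendsto_one_zero_of_same_limit
    (T := fun p : ℝ × ℝ => kernelMixture K (α p.1) (β p.1) p.1)
    (nonDegenerate_limitMixture hG ρ k) (limitMixture_top hGtop ρ k) ?_ (fun g hg => ?_)
    fun g hg => ?_
  · filter_upwards [ht, hc] with p hp hpc
    exact div_pos (hα _ (mul_pos hp hpc)) (hα _ hp)
  · simp_rw [integral_kernelMixture _ _ _ hg, intervalIntegral.integral_of_le one_le_two]
    -- For the normalization at t itself, c is frozen at 1.
    have h := (tendsto_kernelMixture hα hconv hERV hg).comp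
      ((tendsto_fst (f := (atTop : Filter ℝ)) (g := 𝓝 (1 : ℝ))).prodMk
        (tendsto_const_pure.mono_right (pure_le_nhds 1)))
    simpa [Function.comp_def] using h
  · have h1 : Tendsto (fun p : ℝ × ℝ => (p.1 * p.2, p.2)) (atTop ×ˢ 𝓝 1) (atTop ×ˢ 𝓝 1) :=
      (tendsto_fst_mul_snd one_pos).prodMk tendsto_snd
    have h2 := (tendsto_snd (f := (atTop : Filter ℝ)) (g := 𝓝 (1 : ℝ))).mul
      ((tendsto_kernelMixture hα hconv hERV hg).comp h1)
    rw [one_mul] at h2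
    refine h2.congr' ?_
    filter_upwards [ht, hc] with p hp hpc
    have h6 : 0 < p.1 * p.2 := mul_pos hp hpc
    have h7 := integral_kernelMixture (K := K) (α p.1) (β p.1) p.1
      (hg.comp (continuous_standardize (div_pos (hα _ h6) (hα _ hp))
        ((β (p.1 * p.2) - β p.1) / α p.1)))
    simp only [Function.comp_apply] at h7 ⊢
    rw [h7]
    simp_rw [standardize_standardize_ratio (hα _ hp) (hα _ h6)]
    rw [← intervalIntegral.integral_of_le (by gcongr; exact one_le_two)]
    -- Substituting u ↦ cu turns the mixture of K(tu) over (1,2] into c times that of K(tcu) over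
    -- (1/c,2/c], now normalized at its own time tc.
    have h8 := intervalIntegral.mul_integral_comp_mul_left (a := 1 / p.2) (b := 2 / p.2)
      (f := fun u => ∫ e, g (standardize (α (p.1 * p.2)) (β (p.1 * p.2)) e) ∂(K (p.1 * u))) p.2
    rw [mul_div_cancel₀ _ hpc.ne', mul_div_cancel₀ _ hpc.ne'] at h8
    rw [← h8]
    simp_rw [mul_assoc]

end kernel

/-! ### Local uniformity of extended regular variation -/

/-- The uniform convergence theorem for extended regularly varying functions. -/
theorem ERV.tendsto_prod {α β : ℝ → ℝ} {ρ k : ℝ} (hERV : ERV ρ k α β)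
    (hα : ∀ t : ℝ, 0 < t → 0 < α t) (h1 : SlowlyVaryingNearOne α β) {u : ℝ} (hu : 0 < u) :
    Tendsto (fun p : ℝ × ℝ => α (p.1 * p.2) / α p.1) (atTop ×ˢ 𝓝 u) (𝓝 (u ^ ρ)) ∧
    Tendsto (fun p : ℝ × ℝ => (β (p.1 * p.2) - β p.1) / α p.1) (atTop ×ˢ 𝓝 u)
      (𝓝 (psi ρ k u)) := by
  -- The passage from t to tv is split as t → tu → tu · (v/u): the first step has fixed ratio u, the
  -- second a ratio tending to 1.
  have h2 : Tendsto (fun p : ℝ × ℝ => (p.1 * u, p.2 / u)) (atTop ×ˢ 𝓝 u) (atTop ×ˢ 𝓝 1) := by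
    refine (tendsto_fst.atTop_mul_const hu).prodMk ?_
    have := (tendsto_snd (f := (atTop : Filter ℝ)) (g := 𝓝 u)).div_const u
    rwa [div_self hu.ne'] at this
  have hA := ((continuous_fst.tendsto _).comp h1).comp h2
  have hB := ((continuous_snd.tendsto _).comp h1).comp h2
  have hA' := (hERV.1 u hu).comp (tendsto_fst (f := (atTop : Filter ℝ)) (g := 𝓝 u))
  have hB' := (hERV.2 u hu).comp (tendsto_fst (f := (atTop : Filter ℝ)) (g := 𝓝 u))
  have ht : ∀ᶠ p : ℝ × ℝ in atTop ×ˢ 𝓝 u, 0 < p.1 := tendsto_fst.eventually_gt_atTop 0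
  have he : ∀ p : ℝ × ℝ, p.1 * u * (p.2 / u) = p.1 * p.2 := fun p => by field_simp
  constructor
  · have h := hA'.mul hA
    rw [mul_one] at h
    refine h.congr' ?_
    filter_upwards [ht] with p hp
    have := hα _ hp
    have := hα _ (mul_pos hp hu)
    simp only [Function.comp_apply, he]
    field_simp
  · have h := (hA'.mul hB).add hB'
    rw [mul_zero, zero_add] at h
    refine h.congr' ?_
    filter_upwards [ht] with p hp
    have := hα _ hp
    have := hα _ (mul_pos hp hu)
    simp only [Function.comp_apply, he]
    field_simp
    ring

/-! ### The radial component -/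

/-- The measure `u ^ (-2) du` on `(0, ∞)`. -/
def paretoIntensity : Measure ℝ :=
  (volume.restrict (Ioi 0)).withDensity fun u => ENNReal.ofReal (u ^ (-2 : ℝ))

theorem measurable_rpow_neg_two : Measurable fun u : ℝ => ENNReal.ofReal (u ^ (-2 : ℝ)) := by
  fun_prop

instance : SFinite paretoIntensity := by
  unfold paretoIntensity
  infer_instance

theorem setLIntegral_paretoIntensity {s : Set ℝ} (hs : MeasurableSet s) {f : ℝ → ENNReal}
    (hf : Measurable f) :
    ∫⁻ u in s, f u ∂paretoIntensity =
      ∫⁻ u in s ∩ Ioi 0, f u * ENNReal.ofReal (u ^ (-2 : ℝ)) := by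
  rw [paretoIntensity, restrict_withDensity hs, Measure.restrict_restrict hs,
    lintegral_withDensity_eq_lintegral_mul _ measurable_rpow_neg_two hf]
  simp_rw [Pi.mul_apply, mul_comm]

theorem paretoIntensity_Ioi {y : ℝ} (hy : 0 < y) :
    paretoIntensity (Ioi y) = ENNReal.ofReal y⁻¹ := by
  have h := setLIntegral_paretoIntensity (measurableSet_Ioi (a := y)) (measurable_const (a := 1))
  have h1 : Ioi y ∩ Ioi 0 = Ioi y := inter_eq_left.2 (Ioi_subset_Ioi hy.le)
  rw [setLIntegral_one, h1] at h
  simp_rw [one_mul] at h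
  rw [h, ← ofReal_integral_eq_lintegral_ofReal (integrableOn_Ioi_rpow_of_lt (by norm_num) hy),
    integral_Ioi_rpow_of_lt (by norm_num) hy]
  · congr 1
    norm_num
    rw [Real.rpow_neg_one]
  · exact (ae_restrict_iff' measurableSet_Ioi).2
      (ae_of_all _ fun u hu => Real.rpow_nonneg (hy.le.trans (le_of_lt hu)) _)

theorem paretoIntensity_Iic_zero : paretoIntensity (Iic 0) = 0 := by
  have h := setLIntegral_paretoIntensity (measurableSet_Iic (a := (0 : ℝ)))
    (measurable_const (a := 1))
  rwa [setLIntegral_one, Iic_inter_Ioi, Ioc_self, setLIntegral_empty] at h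

section radial

variable {Ω : Type*} [MeasurableSpace Ω] {P : Measure Ω} [IsProbabilityMeasure P] {Y : Ω → ℝ}

open Classical in
/-- The law of `Y / t` conditionally on `Y > δ t` (a Dirac mass if this event is null). -/
def exceedanceMeasure (P : Measure Ω) (Y : Ω → ℝ) (δ t : ℝ) : Measure ℝ :=
  if P {ω | t * δ < Y ω} = 0 then Measure.dirac 0
  else (ProbabilityTheory.cond P {ω | t * δ < Y ω}).map fun ω => Y ω / t

theorem isProbabilityMeasure_exceedanceMeasure (hY : Measurable Y) (δ t : ℝ) :
    IsProbabilityMeasure (exceedanceMeasure P Y δ t) := by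
  unfold exceedanceMeasure
  split_ifs with h
  · infer_instance
  · have := cond_isProbabilityMeasure h
    exact Measure.isProbabilityMeasure_map (by fun_prop)

/-- `exceedanceMeasure` as a probability measure. -/
def exceedanceLaw (P : Measure Ω) [IsProbabilityMeasure P] {Y : Ω → ℝ} (hY : Measurable Y)
    (δ t : ℝ) : ProbabilityMeasure ℝ :=
  ⟨exceedanceMeasure P Y δ t, isProbabilityMeasure_exceedanceMeasure hY δ t⟩

theorem coe_exceedanceLaw (hY : Measurable Y) {δ t : ℝ} (h : P {ω | t * δ < Y ω} ≠ 0) :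
    (exceedanceLaw P hY δ t : Measure ℝ) =
      (ProbabilityTheory.cond P {ω | t * δ < Y ω}).map fun ω => Y ω / t :=
  if_neg h

/-- The standard Pareto law on `(δ, ∞)`. -/
def paretoLaw {δ : ℝ} (hδ : 0 < δ) : ProbabilityMeasure ℝ :=
  ⟨ENNReal.ofReal δ • paretoIntensity.restrict (Ioi δ), ⟨by
    rw [Measure.smul_apply, Measure.restrict_apply_univ, paretoIntensity_Ioi hδ, smul_eq_mul,
      ← ENNReal.ofReal_mul hδ.le, mul_inv_cancel₀ hδ.ne', ENNReal.ofReal_one]⟩⟩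

theorem paretoLaw_real_Ioi {δ : ℝ} (hδ : 0 < δ) (y : ℝ) :
    (paretoLaw hδ : Measure ℝ).real (Ioi y) = δ * (max y δ)⁻¹ := by
  have : (paretoLaw hδ : Measure ℝ) = ENNReal.ofReal δ • paretoIntensity.restrict (Ioi δ) := rfl
  rw [this, measureReal_ennreal_smul_apply, measureReal_restrict_apply measurableSet_Ioi,
    Ioi_inter_Ioi, measureReal_def, paretoIntensity_Ioi (lt_max_of_lt_right hδ),
    ENNReal.toReal_ofReal hδ.le, ENNReal.toReal_ofReal (by positivity)]

theorem exceedanceLaw_real_Ioi (hY : Measurable Y) {δ t : ℝ} (ht : 0 < t)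
    (h : P {ω | t * δ < Y ω} ≠ 0) (y : ℝ) :
    (exceedanceLaw P hY δ t : Measure ℝ).real (Ioi y) =
      (P.real {ω | t * δ < Y ω})⁻¹ * P.real {ω | t * max y δ < Y ω} := by
  have hs : MeasurableSet {ω | t * δ < Y ω} := measurableSet_lt measurable_const hY
  rw [coe_exceedanceLaw hY h, map_measureReal_apply (by fun_prop) measurableSet_Ioi,
    measureReal_def, cond_apply hs, ENNReal.toReal_mul, ENNReal.toReal_inv, measureReal_def,
    measureReal_def]
  congr 3
  ext ω
  simp only [mem_inter_iff, mem_ofPred_eq, mem_preimage, mem_Ioi, lt_div_iff₀ ht,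
    mul_max_of_nonneg _ _ ht.le, max_lt_iff]
  rw [mul_comm y t, and_comm]

theorem integral_exceedanceLaw (hY : Measurable Y) {δ t : ℝ} (ht : 0 < t)
    (h : P {ω | t * δ < Y ω} ≠ 0) {F : ℝ → ℝ} (hF : Continuous F) (hF0 : ∀ u ≤ δ, F u = 0) :
    ∫ u, F u ∂(exceedanceLaw P hY δ t : Measure ℝ) =
      (P.real {ω | t * δ < Y ω})⁻¹ * ∫ ω, F (Y ω / t) ∂P := by
  rw [coe_exceedanceLaw hY h, integral_map (by fun_prop) hF.aestronglyMeasurable,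
    ProbabilityTheory.cond, integral_smul_measure,
    setIntegral_eq_integral_of_forall_compl_eq_zero, ENNReal.toReal_inv, smul_eq_mul]
  · rfl
  · intro ω hω
    refine hF0 _ ?_
    rw [div_le_iff₀ ht, mul_comm]
    exact not_lt.1 hω

theorem eventually_exceedance_ne_zero {P : Measure Ω} (hDA : StdDomainOfAttraction P Y) {δ : ℝ} (hδ : 0 < δ) :
    ∀ᶠ t in atTop, 0 < t ∧ P {ω | t * δ < Y ω} ≠ 0 := by
  filter_upwards [eventually_gt_atTop 0,
    (hDA δ hδ).eventually_const_lt (inv_pos.2 hδ)] with t ht h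
  refine ⟨ht, fun h0 => ?_⟩
  rw [measureReal_def, h0] at h
  simp at h

/-- Conditioning on Y > δt turns vague convergence away from 0 into weak convergence of probability
measures. The tails converge at every point, hence so do the masses of the intervals (a,b], a
π-system containing small neighbourhoods of every point. -/
theorem tendsto_exceedanceLaw (hY : Measurable Y) (hDA : StdDomainOfAttraction P Y) {δ : ℝ}
    (hδ : 0 < δ) : Tendsto (exceedanceLaw P hY δ) atTop (𝓝 (paretoLaw hδ)) := by
  have hIoi : ∀ y, Tendsto (fun t => (exceedanceLaw P hY δ t : Measure ℝ).real (Ioi y)) atTop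
      (𝓝 ((paretoLaw hδ : Measure ℝ).real (Ioi y))) := by
    intro y
    rw [paretoLaw_real_Ioi hδ]
    have h := ((hDA δ hδ).inv₀ (inv_pos.2 hδ).ne').mul (hDA (max y δ) (lt_max_of_lt_right hδ))
    rw [inv_inv] at h
    refine h.congr' ?_
    filter_upwards [eventually_exceedance_ne_zero hDA hδ] with t ht
    rw [exceedanceLaw_real_Ioi hY ht.1 ht.2]
    have := ht.1.ne'
    rw [mul_inv]
    field_simp
  refine IsPiSystem.tendsto_probabilityMeasure_of_tendsto_of_mem
    (isPiSystem_Ioc (id : ℝ → ℝ) id) ?_ ?_ ?_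
  · rintro _ ⟨a, b, -, rfl⟩
    exact measurableSet_Ioc
  · intro U hU x hx
    obtain ⟨ε, hε, hball⟩ := Metric.isOpen_iff.1 hU x hx
    refine ⟨Ioc (x - ε / 2) (x + ε / 2), ⟨x - ε / 2, x + ε / 2, by simp only [id]; linarith, rfl⟩,
      Ioc_mem_nhds (by linarith) (by linarith), fun z hz => hball ?_⟩
    rw [Metric.mem_ball, Real.dist_eq, abs_lt]
    constructor <;> linarith [hz.1, hz.2]
  · rintro _ ⟨a, b, hab, rfl⟩
    have hdiff : ∀ m : ProbabilityMeasure ℝ, ((m (Ioc a b) : NNReal) : ℝ) =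
        (m : Measure ℝ).real (Ioi a) - (m : Measure ℝ).real (Ioi b) := by
      intro m
      have hab' : a ≤ b := le_of_lt hab
      rw [← measureReal_sdiff (μ := (m : Measure ℝ)) (Ioi_subset_Ioi hab') measurableSet_Ioi,
        Ioi_sdiff_Ioi]
      rfl
    rw [← NNReal.tendsto_coe]
    simp only [id, hdiff]
    exact (hIoi a).sub (hIoi b)

/-- Vague convergence of the laws of `Y / t`, scaled by `t`, to `u ^ (-2) du`. -/
theorem tendsto_integral_radial (hY : Measurable Y) (hDA : StdDomainOfAttraction P Y) {δ : ℝ}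
    (hδ : 0 < δ) {F : ℝ → ℝ} (hF : Continuous F) {C : ℝ} (hC : ∀ u, ‖F u‖ ≤ C)
    (hF0 : ∀ u ≤ δ, F u = 0) :
    Tendsto (fun t => t * ∫ ω, F (Y ω / t) ∂P) atTop (𝓝 (∫ u, F u ∂paretoIntensity)) := by
  have h := ProbabilityMeasure.tendsto_iff_forall_integral_tendsto.1
    (tendsto_exceedanceLaw hY hDA hδ) (BoundedContinuousFunction.ofNormedAddCommGroup F hF C hC)
  have h1 := (hDA δ hδ).mul h
  have h2 : ∫ u, F u ∂(paretoLaw hδ : Measure ℝ) = δ * ∫ u, F u ∂paretoIntensity := by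
    have : (paretoLaw hδ : Measure ℝ) = ENNReal.ofReal δ • paretoIntensity.restrict (Ioi δ) := rfl
    rw [this, integral_smul_measure, ENNReal.toReal_ofReal hδ.le, smul_eq_mul,
      setIntegral_eq_integral_of_forall_compl_eq_zero (s := Ioi δ)
        fun u hu => hF0 u (not_lt.1 hu)]
  have h3 : δ⁻¹ * ∫ u, F u ∂(paretoLaw hδ : Measure ℝ) = ∫ u, F u ∂paretoIntensity := by
    rw [h2, ← mul_assoc, inv_mul_cancel₀ hδ.ne', one_mul]
  rw [← h3]
  refine h1.congr' ?_
  filter_upwards [eventually_exceedance_ne_zero hDA hδ] with t ht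
  have h4 : P.real {ω | t * δ < Y ω} ≠ 0 := by
    rw [measureReal_def, ENNReal.toReal_ne_zero]
    exact ⟨ht.2, measure_ne_top _ _⟩
  have h5 := integral_exceedanceLaw hY ht.1 ht.2 hF hF0
  simp only [BoundedContinuousFunction.coe_ofNormedAddCommGroup]
  rw [h5]
  field_simp

/-- Functions `F t` converging locally uniformly on `(0, ∞)` may replace a fixed function in the
vague convergence of `Y / t`. -/
theorem tendsto_integral_radial_of_tendsto_prod (hY : Measurable Y)
    (hDA : StdDomainOfAttraction P Y) {δ : ℝ}
    (hδ : 0 < δ) {F : ℝ → ℝ} (hF : Continuous F) {H : ℝ → ℝ → ℝ} (hH : ∀ t, Measurable (H t))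
    {C : ℝ} (hC : ∀ u, ‖F u‖ ≤ C) (hHC : ∀ t u, ‖H t u‖ ≤ C) (hF0 : ∀ u ≤ δ, F u = 0)
    (hH0 : ∀ t, ∀ u ≤ δ, H t u = 0)
    (hHF : ∀ u, 0 < u → Tendsto (fun p : ℝ × ℝ => H p.1 p.2) (atTop ×ˢ 𝓝 u) (𝓝 (F u))) :
    Tendsto (fun t => t * ∫ ω, H t (Y ω / t) ∂P) atTop (𝓝 (∫ u, F u ∂paretoIntensity)) := by
  have hC0 : 0 ≤ C := (norm_nonneg _).trans (hC 0)
  have hlim := tendsto_integral_radial hY hDA hδ hF hC hF0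
  have hdiff : Tendsto (fun t => t * ∫ ω, H t (Y ω / t) ∂P - t * ∫ ω, F (Y ω / t) ∂P) atTop
      (𝓝 0) := by
    rw [Metric.tendsto_nhds]
    intro ε hε
    -- With this choice the region Y > Mt costs asymptotically 2C/M ≤ ε/4. Uniform error εδ/4 on
    -- [δ,M] against mass tending to 1/δ costs another ε/4.
    set M := 8 * C / ε + δ + 1 with hM
    have hM0 : 0 < M := by positivity
    have hunif : TendstoUniformlyOn H F atTop (Icc δ M) := by
      rw [← tendstoLocallyUniformlyOn_iff_tendstoUniformlyOn_of_compact isCompact_Icc,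
        tendstoLocallyUniformlyOn_iff_forall_tendsto]
      intro u hu
      have hmono : (atTop : Filter ℝ) ×ˢ 𝓝[Icc δ M] u ≤ atTop ×ˢ 𝓝 u :=
        prod_mono le_rfl nhdsWithin_le_nhds
      rw [uniformity_eq_comap_nhds_zero, tendsto_comap_iff]
      have := ((hHF u (hδ.trans_le hu.1)).sub ((hF.tendsto u).comp tendsto_snd)).mono_left hmono
      rwa [sub_self] at this
    have hbd := ((hDA δ hδ).const_mul (ε * δ / 4)).add ((hDA M hM0).const_mul (2 * C))
    have hbd' : ε * δ / 4 * δ⁻¹ + 2 * C * M⁻¹ < ε := by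
      have h1 : ε * δ / 4 * δ⁻¹ = ε / 4 := by field_simp
      have h2 : 2 * C * M⁻¹ ≤ ε / 4 := by
        rw [← div_eq_mul_inv, div_le_iff₀ hM0, hM]
        have : ε / 4 * (8 * C / ε + δ + 1) = 2 * C + ε / 4 * (δ + 1) := by field_simp; ring
        rw [this]
        have : 0 < ε / 4 * (δ + 1) := by positivity
        linarith
      linarith
    filter_upwards [hbd.eventually_lt_const hbd', eventually_gt_atTop 0,
      Metric.tendstoUniformlyOn_iff.1 hunif (ε * δ / 4) (by positivity)] with t h1 ht h2
    have hmY : Measurable fun ω => Y ω / t := by fun_prop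
    have hi1 : Integrable (fun ω => H t (Y ω / t)) P :=
      Integrable.of_bound ((hH t).comp hmY).aestronglyMeasurable C (ae_of_all _ fun _ => hHC _ _)
    have hi2 : Integrable (fun ω => F (Y ω / t)) P :=
      Integrable.of_bound (hF.measurable.comp hmY).aestronglyMeasurable C
        (ae_of_all _ fun _ => hC _)
    have hsδ : MeasurableSet {ω | t * δ < Y ω} := measurableSet_lt measurable_const hY
    have hsM : MeasurableSet {ω | t * M < Y ω} := measurableSet_lt measurable_const hY
    have hj1 : Integrable ({ω | t * δ < Y ω}.indicator fun _ => ε * δ / 4) P :=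
      (integrable_const _).indicator hsδ
    have hj2 : Integrable ({ω | t * M < Y ω}.indicator fun _ => 2 * C) P :=
      (integrable_const _).indicator hsM
    have hnorm : ‖∫ ω, (H t (Y ω / t) - F (Y ω / t)) ∂P‖ ≤
        ∫ ω, ({ω | t * δ < Y ω}.indicator (fun _ => ε * δ / 4) ω +
          {ω | t * M < Y ω}.indicator (fun _ => 2 * C) ω) ∂P := by
      refine norm_integral_le_of_norm_le (hj1.add hj2) (ae_of_all _ fun ω => ?_)
      by_cases hωδ : t * δ < Y ω
      · rw [indicator_of_mem (show ω ∈ {ω | t * δ < Y ω} from hωδ)]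
        by_cases hωM : t * M < Y ω
        · rw [indicator_of_mem (show ω ∈ {ω | t * M < Y ω} from hωM)]
          have := (norm_sub_le _ _).trans (add_le_add (hHC t (Y ω / t)) (hC (Y ω / t)))
          have : 0 < ε * δ / 4 := by positivity
          linarith
        · rw [indicator_of_notMem (show ω ∉ {ω | t * M < Y ω} from hωM), add_zero]
          have := h2 (Y ω / t) ⟨by rw [le_div_iff₀ ht]; linarith, by
            rw [div_le_iff₀ ht]; linarith⟩
          rw [dist_comm, dist_eq_norm] at this
          exact this.le
      · have hu : Y ω / t ≤ δ := by rw [div_le_iff₀ ht]; linarith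
        rw [hH0 t _ hu, hF0 _ hu, sub_self, norm_zero]
        exact add_nonneg (indicator_nonneg (fun _ _ => by positivity) _)
          (indicator_nonneg (fun _ _ => by positivity) _)
    rw [integral_add hj1 hj2, integral_indicator_const _ hsδ, integral_indicator_const _ hsM,
      smul_eq_mul, smul_eq_mul] at hnorm
    rw [dist_zero_right, ← mul_sub, ← integral_sub hi1 hi2, norm_mul, Real.norm_of_nonneg ht.le]
    calc _ ≤ t * (P.real {ω | t * δ < Y ω} * (ε * δ / 4) +
          P.real {ω | t * M < Y ω} * (2 * C)) := by gcongr
      _ = ε * δ / 4 * (t * P.real {ω | t * δ < Y ω}) +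
          2 * C * (t * P.real {ω | t * M < Y ω}) := by ring
      _ < ε := h1
  simpa using hdiff.add hlim

end radial

/-! ### The limit measure -/

/-- The candidate limit measure: the image of `u ^ (-2) du × G` under
`(u, z) ↦ (u ^ ρ z + ψ u, u)`. -/
def limitMeasure (G : ProbabilityMeasure EReal) (ρ k : ℝ) : Measure Cone :=
  ((paretoIntensity.prod (G : Measure EReal)).map
    fun p => (affineMap ρ k p.1 p.2, (p.1 : EReal))).comap (Prod.map id Subtype.val)

section limitMeasure

variable (G : ProbabilityMeasure EReal) (ρ k : ℝ)

theorem measurable_affineMap_prodMk :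
    Measurable fun p : ℝ × EReal => (affineMap ρ k p.1 p.2, (p.1 : EReal)) :=
  (measurable_affineMap ρ k).prodMk (by fun_prop)

/-- The intensity charges only u > 0, so the image already lives on the cone and pulling it back
loses no mass. -/
theorem map_limitMeasure : (limitMeasure G ρ k).map (Prod.map id Subtype.val) =
    (paretoIntensity.prod (G : Measure EReal)).map
      fun p => (affineMap ρ k p.1 p.2, (p.1 : EReal)) := by
  rw [limitMeasure, measurableEmbedding_cone.map_comap]
  refine Measure.restrict_eq_self_of_ae_mem ?_
  refine (ae_map_iff (measurable_affineMap_prodMk ρ k).aemeasurable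
    measurableEmbedding_cone.measurableSet_range).2 ?_
  rw [ae_iff]
  refine measure_mono_null (t := Iic 0 ×ˢ univ) ?_ ?_
  · rintro ⟨u, z⟩ h
    refine ⟨not_lt.1 fun (hu : 0 < u) => h ⟨(affineMap ρ k u z, ⟨(u : EReal), ?_⟩), rfl⟩, mem_univ _⟩
    exact EReal.coe_pos.2 hu
  · rw [Measure.prod_prod, paretoIntensity_Iic_zero, zero_mul]

theorem limitMeasure_preimage {A B : Set EReal} (hA : MeasurableSet A) (hB : MeasurableSet B) :
    limitMeasure G ρ k {p : Cone | p.1 ∈ A ∧ (p.2 : EReal) ∈ B} =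
      ∫⁻ u in ((↑) : ℝ → EReal) ⁻¹' B ∩ Ioi 0,
        (G : Measure EReal) (affineMap ρ k u ⁻¹' A) * ENNReal.ofReal (u ^ (-2 : ℝ)) := by
  have h1 : {p : Cone | p.1 ∈ A ∧ (p.2 : EReal) ∈ B} =
      (Prod.map id Subtype.val : Cone → EReal × EReal) ⁻¹' (A ×ˢ B) := rfl
  have hB' : MeasurableSet (((↑) : ℝ → EReal) ⁻¹' B) := measurable_coe_real_ereal hB
  have hm : Measurable fun u => (G : Measure EReal) (affineMap ρ k u ⁻¹' A) :=
    measurable_measure_prodMk_left (measurable_affineMap ρ k hA)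
  rw [h1, ← measurableEmbedding_cone.map_apply, map_limitMeasure,
    Measure.map_apply (measurable_affineMap_prodMk ρ k) (hA.prod hB),
    Measure.prod_apply (measurable_affineMap_prodMk ρ k (hA.prod hB)),
    ← setLIntegral_paretoIntensity hB' hm, ← lintegral_indicator hB']
  refine lintegral_congr fun u => ?_
  by_cases hu : (u : EReal) ∈ B
  · rw [indicator_of_mem (show u ∈ ((↑) : ℝ → EReal) ⁻¹' B from hu)]
    congr 1
    ext z
    simp [hu]
  · rw [indicator_of_notMem (show u ∉ ((↑) : ℝ → EReal) ⁻¹' B from hu)]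
    convert measure_empty (μ := (G : Measure EReal))
    ext z
    simp [hu]

theorem limitMeasure_Ioi {A : Set EReal} (hA : MeasurableSet A) {y : ℝ} (hy : 0 < y) :
    limitMeasure G ρ k {p : Cone | p.1 ∈ A ∧ (y : EReal) < (p.2 : EReal)} =
      ∫⁻ u in Ioi y,
        (G : Measure EReal) (affineMap ρ k u ⁻¹' A) * ENNReal.ofReal (u ^ (-2 : ℝ)) := by
  have h := limitMeasure_preimage G ρ k hA (measurableSet_Ioi (a := (y : EReal)))
  have h1 : ((↑) : ℝ → EReal) ⁻¹' Ioi (y : EReal) ∩ Ioi 0 = Ioi y := by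
    ext u
    simp only [mem_inter_iff, mem_preimage, mem_Ioi, EReal.coe_lt_coe_iff]
    exact ⟨fun h => h.1, fun h => ⟨h, hy.trans h⟩⟩
  rw [h1] at h
  exact h

theorem limitMeasure_eq_limitFun (x : ℝ) {y : ℝ} (hy : 0 < y) :
    limitMeasure G ρ k {p : Cone | p.1 ≤ (x : EReal) ∧ (y : EReal) < (p.2 : EReal)} =
      limitFun (G : Measure EReal) ρ k x y := by
  have h := limitMeasure_Ioi G ρ k (measurableSet_Iic (a := (x : EReal))) hy
  refine h.trans (setLIntegral_congr_fun measurableSet_Ioi fun u hu => ?_)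
  rw [affineMap_preimage_Iic ρ k (hy.trans hu)]

theorem slice_limitMeasure {A : Set EReal} (hA : MeasurableSet A) {y : ℝ} (hy : 0 < y) :
    slice (limitMeasure G ρ k) y A = ∫⁻ u in Ioi y,
        (G : Measure EReal) (affineMap ρ k u ⁻¹' A) * ENNReal.ofReal (u ^ (-2 : ℝ)) := by
  rw [← limitMeasure_Ioi G ρ k hA hy, slice, Measure.map_apply measurable_fst hA,
    Measure.restrict_apply (measurable_fst hA)]
  rfl

variable {G}

theorem condNonDegenerate_limitMeasure (hGtop : (G : Measure EReal) {⊤} = 0)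
    (hG : NonDegenerate (G : Measure EReal)) : CondNonDegenerate (limitMeasure G ρ k) := by
  refine fun y hy => ⟨fun c h => ?_, ?_⟩
  · rw [slice_limitMeasure G ρ k (measurableSet_range_diff c) hy, lintegral_eq_zero_iff] at h
    · have h1 := (ae_restrict_iff' measurableSet_Ioi).1 h
      have h2 : ∀ᵐ u : ℝ, u ∉ Ioi y := by
        filter_upwards [h1] with u hu huI
        have hu0 : 0 < u := hy.trans huI
        have := hu huI
        simp only [Pi.zero_apply, mul_eq_zero, ENNReal.ofReal_eq_zero] at this
        rw [affineMap_preimage_range_diff ρ k hu0] at this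
        rcases this with h3 | h3
        · exact hG _ h3
        · exact absurd h3 (not_le.2 (Real.rpow_pos_of_pos hu0 _))
      have h3 : volume (Ioi y) = 0 := measure_mono_null (fun u hu => not_not.2 hu) (ae_iff.1 h2)
      simp at h3
    · exact (measurable_measure_prodMk_left
        (measurable_affineMap ρ k (measurableSet_range_diff c))).mul measurable_rpow_neg_two
  · rw [slice_limitMeasure G ρ k (measurableSet_singleton _) hy]
    refine (setLIntegral_congr_fun measurableSet_Ioi fun u hu => ?_).trans lintegral_zero
    rw [affineMap_preimage_top ρ k (hy.trans hu), hGtop, zero_mul]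

theorem CondNonDegenerate.ne_zero {μ : Measure Cone} (hμ : CondNonDegenerate μ) : μ ≠ 0 := by
  rintro rfl
  refine (hμ 1 one_pos).1 0 ?_
  simp [slice]

theorem exists_le_of_isCompact {s : Set Cone} (hs : IsCompact s) :
    ∃ δ : ℝ, 0 < δ ∧ ∀ p ∈ s, (δ : EReal) < p.2 := by
  rcases s.eq_empty_or_nonempty with rfl | hne
  · exact ⟨1, one_pos, by simp⟩
  · obtain ⟨p, hp, hmin⟩ := hs.exists_isMinOn hne (f := fun p : Cone => (p.2 : EReal))
      (by fun_prop)
    obtain ⟨δ, h1, h2⟩ := EReal.lt_iff_exists_real_btwn.1 (show (0 : EReal) < p.2 from p.2.2)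
    exact ⟨δ, EReal.coe_pos.1 h1, fun q hq => h2.trans_le (hmin hq)⟩

theorem isFiniteMeasureOnCompacts_limitMeasure :
    IsFiniteMeasureOnCompacts (limitMeasure G ρ k) := by
  refine ⟨fun s hs => ?_⟩
  obtain ⟨δ, hδ, hsδ⟩ := exists_le_of_isCompact hs
  refine (measure_mono (t := {p : Cone | p.1 ∈ univ ∧ (δ : EReal) < (p.2 : EReal)})
    fun p hp => ⟨mem_univ _, hsδ p hp⟩).trans_lt ?_
  rw [limitMeasure_Ioi G ρ k MeasurableSet.univ hδ]
  simp only [preimage_univ, measure_univ, one_mul]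
  have h := setLIntegral_paretoIntensity (measurableSet_Ioi (a := δ)) (measurable_const (a := 1))
  rw [inter_eq_left.2 (Ioi_subset_Ioi hδ.le), setLIntegral_one, paretoIntensity_Ioi hδ] at h
  simp_rw [one_mul] at h
  rw [← h]
  exact ENNReal.ofReal_lt_top

theorem isOpenEmbedding_cone :
    IsOpenEmbedding (Prod.map id Subtype.val : Cone → EReal × EReal) :=
  IsOpenEmbedding.id.prodMap isOpen_Ioi.isOpenEmbedding_subtypeVal

/-- Continuous functions with compact support in the cone extend by zero to continuous functions
on `[-∞, ∞]²`. -/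
theorem exists_continuous_extension {f : Cone → ℝ} (hf : Continuous f)
    (hfs : HasCompactSupport f) :
    ∃ (f' : EReal × EReal → ℝ) (δ : ℝ), 0 < δ ∧ Continuous f' ∧
      (∀ p : Cone, f' (p.1, p.2) = f p) ∧ ∀ p : EReal × EReal, p.2 ≤ δ → f' p = 0 := by
  obtain ⟨δ, hδ, hsδ⟩ := exists_le_of_isCompact hfs
  have hι := isOpenEmbedding_cone
  refine ⟨Function.extend (Prod.map id Subtype.val) f 0, δ, hδ, ?_, fun p => ?_, fun p hp => ?_⟩
  -- Continuity matters only on the topological support, which is compact and lies inside the open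
  -- image of the cone.
  · refine continuous_of_tsupport fun x hx => ?_
    obtain ⟨c, -, rfl⟩ := hfs.tsupport_extend_zero_subset hι.continuous hx
    rw [← hι.continuousAt_iff, Function.extend_comp hι.injective]
    exact hf.continuousAt
  · exact hι.injective.extend_apply f 0 p
  · by_cases h : ∃ c : Cone, Prod.map id Subtype.val c = p
    · obtain ⟨c, rfl⟩ := h
      rw [hι.injective.extend_apply]
      by_contra hc
      exact absurd (hsδ c (subset_tsupport f hc)) (not_lt.2 hp)
    · rw [Function.extend_apply' _ _ _ h]
      rfl

theorem integral_limitMeasure {f : EReal × EReal → ℝ} (hf : Continuous f) {δ : ℝ} (hδ : 0 < δ)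
    (hf0 : ∀ p : EReal × EReal, p.2 ≤ δ → f p = 0) :
    ∫ p : Cone, f (p.1, p.2) ∂(limitMeasure G ρ k) =
      ∫ u, ∫ z, f (affineMap ρ k u z, (u : EReal)) ∂(G : Measure EReal) ∂paretoIntensity := by
  obtain ⟨C, hC⟩ := isCompact_univ.exists_bound_of_continuousOn (f := f) hf.continuousOn
  have h1 := measurableEmbedding_cone.integral_map (μ := limitMeasure G ρ k) f
  rw [map_limitMeasure, integral_map (measurable_affineMap_prodMk ρ k).aemeasurable
    hf.aestronglyMeasurable] at h1
  refine h1.symm.trans (integral_prod _ ?_)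
  have hs : MeasurableSet (Ioi δ ×ˢ univ : Set (ℝ × EReal)) :=
    measurableSet_Ioi.prod MeasurableSet.univ
  -- The intensity is infinite near 0; the integrand lives on u > δ, where the mass is 1/δ.
  refine (integrableOn_iff_integrable_of_support_subset (s := Ioi δ ×ˢ univ) ?_).1 ?_
  · rintro ⟨u, z⟩ h
    refine ⟨not_le.1 fun hu => h (hf0 _ (EReal.coe_le_coe_iff.2 hu)), mem_univ _⟩
  · refine Measure.integrableOn_of_bounded (M := C) ?_
      (hf.measurable.comp (measurable_affineMap_prodMk ρ k)).aestronglyMeasurable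
      (ae_of_all _ fun p => hC _ (mem_univ _))
    rw [Measure.prod_prod, paretoIntensity_Ioi hδ, measure_univ, mul_one]
    exact ENNReal.ofReal_ne_top

end limitMeasure

/-! ### Vague convergence and uniqueness of the limit -/

section vague

variable {Ω : Type*} [MeasurableSpace Ω] {P : Measure Ω} [IsProbabilityMeasure P] {X Y : Ω → ℝ}
  {K : Kernel ℝ EReal} [IsMarkovKernel K] {α β : ℝ → ℝ} {G : ProbabilityMeasure EReal} {ρ k : ℝ}

/-- The argument of `K` is written t * (Y/t) so that the integrand is a function of Y/t, as the
radial limit theorem requires. -/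
theorem integral_comp_eq_integral_kernel (hX : Measurable X) (hY : Measurable Y)
    (hK : IsCondDistrib P X Y K) {f : EReal × EReal → ℝ} (hf : Continuous f) (a b : ℝ) {t : ℝ}
    (ht : 0 < t) :
    ∫ ω, f (standardize a b (X ω), ((Y ω / t : ℝ) : EReal)) ∂P =
      ∫ ω, (∫ e, f (standardize a b e, ((Y ω / t : ℝ) : EReal)) ∂(K (t * (Y ω / t)))) ∂P := by
  obtain ⟨C, hC⟩ := isCompact_univ.exists_bound_of_continuousOn (f := f) hf.continuousOn
  have hm : Measurable fun p : ℝ × EReal =>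
      f (standardize a b p.2, ((p.1 / t : ℝ) : EReal)) :=
    hf.measurable.comp (((measurable_standardize a b).comp measurable_snd).prodMk (by fun_prop))
  have hmXY : Measurable fun ω => (Y ω, (X ω : EReal)) := hY.prodMk hX.coe_real_ereal
  have h1 := integral_map (μ := P) hmXY.aemeasurable hm.aestronglyMeasurable
  have := Measure.isProbabilityMeasure_map (μ := P) hY.aemeasurable
  have hmI : StronglyMeasurable fun v : ℝ =>
      ∫ e, f (standardize a b e, ((v / t : ℝ) : EReal)) ∂(K v) :=
    StronglyMeasurable.integral_kernel_prod_right' hm.stronglyMeasurable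
  rw [hK, Measure.integral_compProd (Integrable.of_bound hm.aestronglyMeasurable C
    (ae_of_all _ fun p => hC _ (mem_univ _))), integral_map hY.aemeasurable
    hmI.aestronglyMeasurable] at h1
  rw [← h1]
  have ht' := ht.ne'
  simp_rw [fun ω => mul_div_cancel₀ (Y ω) ht']

/-- The extension by 0 is continuous because `f` already vanishes for u ≤ δ; only for u > 0 is
`affineMap` known to vary continuously. -/
theorem continuous_radial_limit {f : EReal × EReal → ℝ} (hf : Continuous f) {δ : ℝ}
    (hδ : 0 < δ) (hf0 : ∀ p : EReal × EReal, p.2 ≤ δ → f p = 0) :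
    Continuous fun u : ℝ =>
      if 0 < u then ∫ z, f (affineMap ρ k u z, (u : EReal)) ∂(G : Measure EReal) else 0 := by
  rw [continuous_iff_continuousAt]
  intro u₀
  rcases lt_or_ge 0 u₀ with hu | hu
  · have h : Tendsto (fun u : ℝ => ∫ z, f (affineMap ρ k u z, (u : EReal)) ∂(G : Measure EReal))
        (𝓝 u₀) (𝓝 (∫ z, f (affineMap ρ k u₀ z, (u₀ : EReal)) ∂(G : Measure EReal))) := by
      refine tendsto_integral_of_tendsto_prod (T := fun _ => (G : Measure EReal))
        (fun g hg => tendsto_const_nhds) ?_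
        (hf.comp ((continuous_affineMap ρ k hu).prodMk continuous_const)) fun z => ?_
      · filter_upwards [lt_mem_nhds hu] with u hu'
        exact hf.comp ((continuous_affineMap ρ k hu').prodMk continuous_const)
      · exact (hf.tendsto _).comp ((tendsto_affineMap ρ k hu tendsto_fst tendsto_snd).prodMk_nhds
          ((continuous_coe_real_ereal.tendsto _).comp tendsto_fst))
    rw [ContinuousAt, if_pos hu]
    refine h.congr' ?_
    filter_upwards [lt_mem_nhds hu] with u hu'
    rw [if_pos hu']
  · rw [ContinuousAt, if_neg (not_lt.2 hu)]
    refine tendsto_const_nhds.congr' ?_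
    filter_upwards [gt_mem_nhds (hu.trans_lt hδ)] with u hu'
    split_ifs
    · have : ∀ z, f (affineMap ρ k u z, (u : EReal)) = 0 := fun z =>
        hf0 _ (EReal.coe_le_coe_iff.2 hu'.le)
      simp [this]
    · rfl

/-- Disintegration reduces the claim to the radial limit of the kernel integrals. These converge
jointly as t → ∞ and u → u₀ > 0 by `ERV.tendsto_prod`. -/
theorem ERV.vagueTendsto (hX : Measurable X) (hY : Measurable Y)
    (hDA : StdDomainOfAttraction P Y) (hK : IsCondDistrib P X Y K)
    (hα : ∀ t : ℝ, 0 < t → 0 < α t) (hGtop : (G : Measure EReal) {⊤} = 0)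
    (hG : NonDegenerate (G : Measure EReal))
    (hconv : Tendsto (scaledKernel K α β) atTop (𝓝 G)) (hERV : ERV ρ k α β) :
    VagueTendsto (scaledLaw P X Y α β) (limitMeasure G ρ k) := by
  intro f₀ hf₀ hfs
  obtain ⟨f, δ, hδ, hf, hff₀, hf0⟩ := exists_continuous_extension hf₀ hfs
  obtain ⟨C, hC⟩ := isCompact_univ.exists_bound_of_continuousOn (f := f) hf.continuousOn
  have hC0 : 0 ≤ C := (norm_nonneg _).trans (hC (⊤, ⊤) (mem_univ _))
  simp_rw [← hff₀]
  rw [integral_limitMeasure ρ k hf hδ hf0]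
  have hnear := hERV.slowlyVaryingNearOne hα hGtop hG hconv
  have hbound : ∀ (m : Measure EReal) [IsProbabilityMeasure m] (g : EReal → EReal × EReal),
      ‖∫ z, f (g z) ∂m‖ ≤ C := fun m _ g => by
    refine (norm_integral_le_of_norm_le_const (ae_of_all _ fun e => hC _ (mem_univ _))).trans ?_
    simp
  have h := tendsto_integral_radial_of_tendsto_prod hY hDA hδ
    (continuous_radial_limit (G := G) (ρ := ρ) (k := k) hf hδ hf0)
    (H := fun t u => ∫ e, f (standardize (α t) (β t) e, (u : EReal)) ∂(K (t * u))) ?_ (C := C)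
    ?_ (fun t u => hbound _ _) ?_ ?_ ?_
  · have hF : ∫ u, (if 0 < u then ∫ z, f (affineMap ρ k u z, (u : EReal)) ∂(G : Measure EReal)
        else 0) ∂paretoIntensity =
        ∫ u, ∫ z, f (affineMap ρ k u z, (u : EReal)) ∂(G : Measure EReal) ∂paretoIntensity := by
      refine integral_congr_ae ?_
      have h0 : ∀ᵐ u ∂paretoIntensity, 0 < u := by
        rw [ae_iff]
        simp only [not_lt]
        exact paretoIntensity_Iic_zero
      filter_upwards [h0] with u hu
      rw [if_pos hu]
    rw [hF] at h
    refine h.congr' ?_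
    filter_upwards [eventually_gt_atTop 0] with t ht
    rw [integral_scaledLaw P hX hY α β ht.le hf.measurable
      (fun p hp => hf0 p (hp.trans (EReal.coe_nonneg.2 hδ.le))),
      integral_comp_eq_integral_kernel hX hY hK hf _ _ ht]
  · intro t
    have hm : Measurable fun p : ℝ × EReal =>
        f (standardize (α t) (β t) p.2, ((p.1 : ℝ) : EReal)) :=
      hf.measurable.comp (((measurable_standardize _ _).comp measurable_snd).prodMk (by fun_prop))
    exact (StronglyMeasurable.integral_kernel_prod_right'
      (κ := K.comap (t * ·) (measurable_const_mul t)) hm.stronglyMeasurable).measurable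
  · intro u
    split_ifs
    · exact hbound _ _
    · simpa using hC0
  · intro u hu
    have : ∀ z, f (affineMap ρ k u z, (u : EReal)) = 0 := fun z =>
      hf0 _ (EReal.coe_le_coe_iff.2 hu)
    simp [this]
  · intro t u hu
    have : ∀ e, f (standardize (α t) (β t) e, (u : EReal)) = 0 := fun z =>
      hf0 _ (EReal.coe_le_coe_iff.2 hu)
    simp [this]
  · intro u hu
    rw [if_pos hu]
    obtain ⟨hA, hB⟩ := hERV.tendsto_prod hα hnear hu
    exact tendsto_integral_kernel hα hconv (Real.rpow_pos_of_pos hu ρ)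
      (tendsto_fst.eventually_gt_atTop 0) (tendsto_fst_mul_snd hu) hA hB
      ((continuous_coe_real_ereal.tendsto _).comp tendsto_snd) hf

theorem ERV.isCEVMLimit (hX : Measurable X) (hY : Measurable Y)
    (hDA : StdDomainOfAttraction P Y) (hK : IsCondDistrib P X Y K)
    (hα : ∀ t : ℝ, 0 < t → 0 < α t) (hGtop : (G : Measure EReal) {⊤} = 0)
    (hG : NonDegenerate (G : Measure EReal))
    (hconv : Tendsto (scaledKernel K α β) atTop (𝓝 G)) (hERV : ERV ρ k α β) :
    IsCEVMLimit P X Y α β (limitMeasure G ρ k) where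
  radon := isFiniteMeasureOnCompacts_limitMeasure ρ k
  tendsto := hERV.vagueTendsto hX hY hDA hK hα hGtop hG hconv
  ne_zero := (condNonDegenerate_limitMeasure ρ k hGtop hG).ne_zero
  nonDegenerate := condNonDegenerate_limitMeasure ρ k hGtop hG

end vague

/-- The cone is locally compact and σ-compact, so compactly supported functions determine measures
finite on compacts. -/
theorem VagueTendsto.unique {m : ℝ → Measure Cone} {μ ν : Measure Cone}
    [IsFiniteMeasureOnCompacts μ] [IsFiniteMeasureOnCompacts ν]
    (hμ : VagueTendsto m μ) (hν : VagueTendsto m ν) : μ = ν := by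
  have : LocallyCompactSpace (Ioi (0 : EReal)) := isOpen_Ioi.locallyCompactSpace
  have : LocallyCompactSpace Cone := inferInstance
  have : SigmaCompactSpace Cone := inferInstance
  exact Measure.ext_of_integral_eq_on_compactlySupported fun f =>
    tendsto_nhds_unique (hμ f f.continuous f.hasCompactSupport)
      (hν f f.continuous f.hasCompactSupport)

/-! ### Continuity of the limit function -/

section continuity

variable {G : Measure EReal} [IsProbabilityMeasure G] {ρ k : ℝ}

theorem continuousAt_measure_Iic {z : ℝ} (hz : G {(z : EReal)} = 0) :
    ContinuousAt (fun x : ℝ => G (Iic (x : EReal))) z := by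
  have h1 : ∀ x : ℝ, G (Iic (x : EReal)) = ∫⁻ e, (Iic (x : EReal)).indicator 1 e ∂G := fun x =>
    (lintegral_indicator_one measurableSet_Iic).symm
  simp_rw [ContinuousAt, h1]
  refine tendsto_lintegral_filter_of_dominated_convergence (fun _ => 1)
    (Eventually.of_forall fun x => measurable_one.indicator measurableSet_Iic)
    (Eventually.of_forall fun x => ae_of_all _ fun e => indicator_le_self' (by simp) e)
    (by simp) ?_
  filter_upwards [compl_mem_ae_iff.2 hz] with e he
  have hcoe := continuous_coe_real_ereal.tendsto z
  rcases lt_or_gt_of_ne (show e ≠ z from he) with h | h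
  · refine tendsto_const_nhds.congr' ?_
    filter_upwards [hcoe.eventually_const_lt h] with x hx
    rw [indicator_of_mem (show e ∈ Iic (z : EReal) from h.le),
      indicator_of_mem (show e ∈ Iic (x : EReal) from hx.le)]
  · refine tendsto_const_nhds.congr' ?_
    filter_upwards [hcoe.eventually_lt_const h] with x hx
    rw [indicator_of_notMem (show e ∉ Iic (z : EReal) from not_le.2 h),
      indicator_of_notMem (show e ∉ Iic (x : EReal) from not_le.2 hx)]

/-- `limitFun` is continuous where almost all its integrands are. -/
theorem continuousAt_limitFun {x y : ℝ} (hy : 0 < y)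
    (h : ∀ᵐ u : ℝ, 0 < u → ContinuousAt (fun x : ℝ => G (Iic (x : EReal)))
      (u ^ (-ρ) * (x - psi ρ k u))) :
    ContinuousAt (fun q : ℝ × ℝ => limitFun G ρ k q.1 q.2) (x, y) := by
  have hmono : Monotone fun x : ℝ => G (Iic (x : EReal)) := fun a b hab =>
    measure_mono (Iic_subset_Iic.2 (EReal.coe_le_coe_iff.2 hab))
  have hψ := measurable_psi ρ k
  have hmeas : ∀ x : ℝ, Measurable fun u : ℝ =>
      G (Iic ((u ^ (-ρ) * (x - psi ρ k u) : ℝ) : EReal)) * ENNReal.ofReal (u ^ (-2 : ℝ)) :=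
    fun x => (hmono.measurable.comp
      (by fun_prop : Measurable fun u : ℝ => u ^ (-ρ) * (x - psi ρ k u))).mul
      measurable_rpow_neg_two
  simp_rw [ContinuousAt, limitFun, ← lintegral_indicator measurableSet_Ioi]
  have hq : Tendsto (fun q : ℝ × ℝ => q.2) (𝓝 (x, y)) (𝓝 y) := continuous_snd.tendsto _
  have hq1 : Tendsto (fun q : ℝ × ℝ => q.1) (𝓝 (x, y)) (𝓝 x) := continuous_fst.tendsto _
  -- Near (x,y) the domain of integration stays inside (y/2,∞), where u^(-2) is integrable.
  refine tendsto_lintegral_filter_of_dominated_convergence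
    ((Ioi (y / 2)).indicator fun u => ENNReal.ofReal (u ^ (-2 : ℝ)))
    (Eventually.of_forall fun q => (hmeas q.1).indicator measurableSet_Ioi) ?_ ?_ ?_
  · filter_upwards [hq.eventually_const_lt (half_lt_self hy)] with q hq
    refine ae_of_all _ fun u => ?_
    by_cases hu : u ∈ Ioi q.2
    · rw [indicator_of_mem hu, indicator_of_mem (show u ∈ Ioi (y / 2) from hq.trans hu)]
      exact mul_le_of_le_one_left zero_le prob_le_one
    · rw [indicator_of_notMem hu]
      exact zero_le
  · rw [lintegral_indicator measurableSet_Ioi]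
    have h2 := setLIntegral_paretoIntensity (measurableSet_Ioi (a := y / 2))
      (measurable_const (a := 1))
    rw [inter_eq_left.2 (Ioi_subset_Ioi (half_pos hy).le), setLIntegral_one,
      paretoIntensity_Ioi (half_pos hy)] at h2
    simp_rw [one_mul] at h2
    rw [← h2]
    exact ENNReal.ofReal_ne_top
  · filter_upwards [h, compl_mem_ae_iff.2 (measure_singleton y)] with u hu huy
    rcases lt_or_gt_of_ne (show u ≠ y from huy) with h3 | h3
    · rw [indicator_of_notMem (show u ∉ Ioi y from not_lt.2 h3.le)]
      refine tendsto_const_nhds.congr' ?_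
      filter_upwards [hq.eventually_const_lt h3] with q hq
      rw [indicator_of_notMem (show u ∉ Ioi q.2 from not_lt.2 hq.le)]
    · rw [indicator_of_mem (show u ∈ Ioi y from h3)]
      have h4 : Tendsto (fun q : ℝ × ℝ => u ^ (-ρ) * (q.1 - psi ρ k u)) (𝓝 (x, y))
          (𝓝 (u ^ (-ρ) * (x - psi ρ k u))) := (hq1.sub_const _).const_mul _
      have h5 := ENNReal.Tendsto.mul_const (b := ENNReal.ofReal (u ^ (-2 : ℝ)))
        ((hu (hy.trans h3)).tendsto.comp h4) (Or.inr ENNReal.ofReal_ne_top)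
      refine h5.congr' ?_
      filter_upwards [hq.eventually_lt_const h3] with q hq
      rw [indicator_of_mem (show u ∈ Ioi q.2 from hq)]
      rfl

/-- The point -k/ρ is fixed by every map z ↦ u^ρ z + ψ(u). Centred there, the argument of `G` is a
pure power of u, constant exactly when x = -k/ρ. -/
theorem rpow_neg_mul_sub_psi (hρ : ρ ≠ 0) (x : ℝ) {u : ℝ} (hu : 0 < u) :
    u ^ (-ρ) * (x - psi ρ k u) = u ^ (-ρ) * (x - -k / ρ) + -k / ρ := by
  have h : u ^ (-ρ) * u ^ ρ = 1 := by rw [← Real.rpow_add hu, neg_add_cancel, Real.rpow_zero]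
  rw [psi, if_neg hρ]
  field_simp
  linear_combination -k * h

/-- A finite measure has countably many atoms, and an injective function of u meets them for
countably many u only. At x = -k/ρ with ρ ≠ 0 the function is constant, and the hypothesis says that
its value is not an atom. -/
theorem ae_measure_singleton_eq_zero (hρk : (ρ, k) ≠ (0, 0)) {x : ℝ}
    (hx : ρ = 0 ∨ x ≠ -k / ρ ∨ G {((-k / ρ : ℝ) : EReal)} = 0) :
    ∀ᵐ u : ℝ, 0 < u → G {((u ^ (-ρ) * (x - psi ρ k u) : ℝ) : EReal)} = 0 := by
  suffices hinj : InjOn (fun u : ℝ => u ^ (-ρ) * (x - psi ρ k u)) (Ioi 0) ∨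
      ∀ u : ℝ, 0 < u → G {((u ^ (-ρ) * (x - psi ρ k u) : ℝ) : EReal)} = 0 by
    rcases hinj with hinj | h
    · have hc : {e : EReal | 0 < G {e' | id e' = e}}.Countable :=
        Measure.countable_meas_level_set_pos measurable_id
      have hc' : {u : ℝ | 0 < u ∧
          0 < G {((u ^ (-ρ) * (x - psi ρ k u) : ℝ) : EReal)}}.Countable := by
        refine MapsTo.countable_of_injOn (t := {e : EReal | 0 < G {e' | id e' = e}})
          (f := fun u : ℝ => ((u ^ (-ρ) * (x - psi ρ k u) : ℝ) : EReal)) (fun u hu => hu.2) ?_ hc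
        exact fun u hu v hv huv => hinj hu.1 hv.1 (EReal.coe_injective huv)
      filter_upwards [compl_mem_ae_iff.2 (hc'.measure_zero volume)] with u hu hu0
      by_contra h
      exact hu ⟨hu0, pos_iff_ne_zero.2 h⟩
    · exact ae_of_all _ h
  by_cases hρ : ρ = 0
  · subst hρ
    have hk : k ≠ 0 := by simpa using hρk
    refine Or.inl fun u hu v hv huv => ?_
    simp only [neg_zero, Real.rpow_zero, one_mul, psi, if_true] at huv
    exact Real.log_injOn_pos hu hv (mul_left_cancel₀ hk (by linarith))
  · by_cases hxk : x = -k / ρ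
    · refine Or.inr fun u hu => ?_
      rw [rpow_neg_mul_sub_psi hρ x hu, hxk, sub_self, mul_zero, zero_add]
      exact (hx.resolve_left hρ).resolve_left (not_not.2 hxk)
    · refine Or.inl fun u hu v hv huv => ?_
      simp only [rpow_neg_mul_sub_psi hρ x hu, rpow_neg_mul_sub_psi hρ x hv] at huv
      have h1 := mul_right_cancel₀ (sub_ne_zero.2 hxk) (add_right_cancel huv)
      exact (Real.rpow_left_inj (le_of_lt hu) (le_of_lt hv) (neg_ne_zero.2 hρ)).1 h1

end continuity

end CEVM

end

theorem theorem4p2 {Ω : Type*} [MeasurableSpace Ω] (P : Measure Ω) [IsProbabilityMeasure P]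
    (X Y : Ω → ℝ) (hX : Measurable X) (hY : Measurable Y) (hY0 : ∀ᵐ ω ∂P, 0 ≤ Y ω)
    (hDA : CEVM.StdDomainOfAttraction P Y)
    (K : Kernel ℝ EReal) [IsMarkovKernel K] (hK : CEVM.IsCondDistrib P X Y K)
    (α β : ℝ → ℝ) (hα : ∀ t : ℝ, 0 < t → 0 < α t)
    (G : ProbabilityMeasure EReal) (hGtop : (G : Measure EReal) {⊤} = 0)
    (hG : CEVM.NonDegenerate (G : Measure EReal))
    (hconv : Tendsto (CEVM.scaledKernel K α β) atTop (𝓝 G)) :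
    ((∃ μ : Measure CEVM.Cone, CEVM.IsCEVMLimit P X Y α β μ) ↔
      ∃ ρ k : ℝ, CEVM.ERV ρ k α β) ∧
    ∀ ρ k : ℝ, CEVM.ERV ρ k α β →
      (∀ μ : Measure CEVM.Cone, CEVM.IsCEVMLimit P X Y α β μ →
        ∀ x y : ℝ, 0 < y →
          μ {p : CEVM.Cone | p.1 ≤ (x : EReal) ∧ (y : EReal) < (p.2 : EReal)} =
            CEVM.limitFun (G : Measure EReal) ρ k x y) ∧
      ((ρ, k) ≠ (0, 0) → ∀ x y : ℝ, 0 < y →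
        (ρ = 0 ∨ x ≠ -k / ρ ∨ (G : Measure EReal) {((-k / ρ : ℝ) : EReal)} = 0) →
          ContinuousAt (fun q : ℝ × ℝ => CEVM.limitFun (G : Measure EReal) ρ k q.1 q.2) (x, y)) ∧
      (Continuous (fun x : ℝ => (G : Measure EReal) (Iic (x : EReal))) →
        ContinuousOn (fun q : ℝ × ℝ => CEVM.limitFun (G : Measure EReal) ρ k q.1 q.2)
          {q : ℝ × ℝ | 0 < q.2}) := by
  refine ⟨⟨fun ⟨μ, hμ⟩ => hμ.exists_erv hX hY hDA hα, fun ⟨ρ, k, hERV⟩ =>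
    ⟨_, hERV.isCEVMLimit hX hY hDA hK hα hGtop hG hconv⟩⟩, fun ρ k hERV => ⟨fun μ hμ x y hy => ?_,
    fun hρk x y hy hx => ?_, fun hcont q hq => ?_⟩⟩
  · have h := hERV.isCEVMLimit hX hY hDA hK hα hGtop hG hconv
    have := h.radon
    have := hμ.radon
    -- Any limit in (a) coincides with the one constructed from `G`, ρ and k.
    rw [CEVM.VagueTendsto.unique hμ.tendsto h.tendsto, CEVM.limitMeasure_eq_limitFun G ρ k x hy]
  · refine CEVM.continuousAt_limitFun hy ?_
    filter_upwards [CEVM.ae_measure_singleton_eq_zero hρk hx] with u hu hu0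
    exact CEVM.continuousAt_measure_Iic (hu hu0)
  · exact (CEVM.continuousAt_limitFun (x := q.1) hq
      (ae_of_all _ fun u _ => hcont.continuousAt)).continuousWithinAt
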